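/- Let $d\ge 1$ and let $\mathcal D\subset\mathbb R^d$ be either a bounded open rectangle or a bounded connected open set whose boundary is a $C^2$ submanifold of dimension $d-1$. Let $T$ be a continuous function with positive values (the temperature), defined on an open neighbourhood $U$ of $\partial\mathcal D$. For $L>0$ let $\mathcal D_L=L\mathcal D\cap\mathbb Z^d$, and let $\mathcal B_L$ be the set of the lattice points outside $\mathcal D_L$ that have a nearest neighbour in $\mathcal D_L$ and a nearest neighbour outside $\mathcal D_L$. Let $M\ge 1$, and consider the continuous-time Markov process $X_t=X_t^{(L)}$ with states $((\xi_v)_{v\in\mathcal D_L},(\eta_1,\dots,\eta_M),(X_1,\dots,X_M))\in\mathbb R_+^{\mathcal D_L}\times\mathbb R_+^M\times\mathcal D_L^M$, where $\mathbb R_+=[0,\infty)$ (site energies, particle energies and particle positions), and with the following dynamics. Each particle $k$ carries an independent exponential clock of rate $1$; when it rings, the particle chooses a nearest neighbour $w$ of its position $X_k$ with probability $\frac1{2d}$ each, and $p\in(0,1)$ is chosen uniformly. - If $w\in\mathcal D_L$, then $\xi_{X_k}$ is replaced by $p(\xi_{X_k}+\eta_k)$, $\eta_k$ by $(1-p)(\xi_{X_k}+\eta_k)$,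 and $X_k$ by $w$. - If $w\in\mathcal B_L$, then $\xi_{X_k}$ is replaced by $p(\xi_{X_k}+\eta_k)$, $\eta_k$ by an independent exponential random variable with mean $T(w/L)$, and $X_k$ is unchanged. - If $w\notin\mathcal D_L\cup\mathcal B_L$ (which does not occur for large $L$), nothing happens. Assume that $L$ is so large that $w/L\in U$ for all $w\in\mathcal B_L$, and that the nearest-neighbour graph of $\mathbb Z^d$ restricted to $\mathcal D_L$ is connected (in particular nonempty). Then the process $X_t^{(L)}$ has a unique invariant probability measure $\mu^{(L)}$. Furthermore, for any initial distribution of $X_0^{(L)}$, the distribution of $X_t^{(L)}$ converges to $\mu^{(L)}$ in total variation (in particular weakly) as $t\to\infty$. -/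

import Mathlib

open MeasureTheory ProbabilityTheory Filter Topology
open scoped NNReal ENNReal Pointwise

noncomputable section

namespace EnergyExchange

/-! ### The lattice and the domain -/

/-- The point of `ℝᵈ` with the same coordinates as the lattice point `v`. -/
def toSpace {d : ℕ} (v : Fin d → ℤ) : EuclideanSpace ℝ (Fin d) :=
  WithLp.toLp 2 fun i => (v i : ℝ)

/-- The `2d` unit steps `± eᵢ` of the lattice `ℤᵈ`. -/
def unitStep {d : ℕ} (a : Fin d × Bool) : Fin d → ℤ :=
  Pi.single a.1 (if a.2 then 1 else -1)

theorem unitStep_not {d : ℕ} (a : Fin d × Bool) : unitStep (a.1, !a.2) = -unitStep a := by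
  rcases a with ⟨i, b⟩
  cases b <;> simp [unitStep, ← Pi.single_neg]

theorem unitStep_ne_zero {d : ℕ} (a : Fin d × Bool) : unitStep a ≠ 0 := by
  intro h
  have := congrFun h a.1
  rcases a with ⟨i, b⟩
  cases b <;> simp [unitStep] at this

/-- The nearest-neighbour graph of `ℤᵈ`. -/
def latticeGraph (d : ℕ) : SimpleGraph (Fin d → ℤ) where
  Adj v w := ∃ a, w = v + unitStep a
  symm := ⟨by
    rintro v w ⟨a, rfl⟩
    exact ⟨(a.1, !a.2), by rw [unitStep_not]; abel⟩⟩
  loopless := ⟨by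
    rintro v ⟨a, h⟩
    exact unitStep_ne_zero a (by simpa using h.symm)⟩

/-- The sites `L D ∩ ℤᵈ`. -/
def sites {d : ℕ} (D : Set (EuclideanSpace ℝ (Fin d))) (L : ℝ) : Set (Fin d → ℤ) :=
  {v | toSpace v ∈ L • D}

/-- The boundary of a set `S` of lattice points: the lattice points that have a neighbour in `S`
and a neighbour outside `S`. -/
def latticeBoundary {d : ℕ} (S : Set (Fin d → ℤ)) : Set (Fin d → ℤ) :=
  {v | (∃ w, (latticeGraph d).Adj v w ∧ w ∈ S) ∧ ∃ w, (latticeGraph d).Adj v w ∧ w ∉ S}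

/-- The location of the bath. -/
def bath {d : ℕ} (S : Set (Fin d → ℤ)) : Set (Fin d → ℤ) := latticeBoundary S \ S

/-- For every neighbourhood `U` of the boundary of a bounded set `D`, the rescaled bath `L⁻¹ B_L`
is contained in `U` if `L` is large enough. -/
theorem exists_bath_subset {d : ℕ} {D U : Set (EuclideanSpace ℝ (Fin d))}
    (hD : Bornology.IsBounded D) (hU : IsOpen U) (hDU : frontier D ⊆ U) :
    ∃ L₀ > 0, ∀ L : ℝ, L₀ ≤ L → ∀ w ∈ bath (sites D L), L⁻¹ • toSpace w ∈ U := by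
  have hc : IsCompact (frontier D) :=
    Metric.isCompact_of_isClosed_isBounded isClosed_frontier
      (hD.closure.subset frontier_subset_closure)
  obtain ⟨δ, hδ, hδU⟩ := hc.exists_thickening_subset_open hU hDU
  refine ⟨2 / δ, by positivity, fun L hL w hw => hδU ?_⟩
  have hL0 : 0 < L := lt_of_lt_of_le (by positivity) hL
  obtain ⟨⟨⟨v, ⟨a, hva⟩, hv⟩, -⟩, hw'⟩ := hw
  have hv1 : L⁻¹ • toSpace v ∈ D := (Set.mem_smul_set_iff_inv_smul_mem₀ hL0.ne' _ _).1 hv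
  have hw1 : L⁻¹ • toSpace w ∉ D := fun h =>
    hw' ((Set.mem_smul_set_iff_inv_smul_mem₀ hL0.ne' _ _).2 h)
  obtain ⟨z, hz, hzD⟩ : ∃ z ∈ segment ℝ (L⁻¹ • toSpace w) (L⁻¹ • toSpace v), z ∈ frontier D := by
    by_contra! hno
    have hsub : segment ℝ (L⁻¹ • toSpace w) (L⁻¹ • toSpace v) ⊆ interior D ∪ (closure D)ᶜ := by
      intro z hz
      by_cases h : z ∈ interior D
      · exact Or.inl h
      · exact Or.inr fun h' => hno z hz ⟨h', h⟩
    obtain ⟨z, -, hz1, hz2⟩ := (convex_segment (𝕜 := ℝ) (L⁻¹ • toSpace w)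
      (L⁻¹ • toSpace v)).isPreconnected _ _ isOpen_interior isClosed_closure.isOpen_compl hsub
      ⟨_, right_mem_segment ℝ _ _, (hsub (right_mem_segment ℝ _ _)).resolve_right
        fun h => h (subset_closure hv1)⟩
      ⟨_, left_mem_segment ℝ _ _, (hsub (left_mem_segment ℝ _ _)).resolve_left
        fun h => hw1 (interior_subset h)⟩
    exact hz2 (subset_closure (interior_subset hz1))
  refine Metric.mem_thickening_iff.2 ⟨z, hzD, ?_⟩
  have h1 : dist (L⁻¹ • toSpace w) z ≤ dist (L⁻¹ • toSpace w) (L⁻¹ • toSpace v) := by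
    have := segment_subset_closedBall_left _ _ hz
    rwa [Metric.mem_closedBall, dist_comm] at this
  have h2 : dist (L⁻¹ • toSpace w) (L⁻¹ • toSpace v) = L⁻¹ := by
    have h3 : toSpace w - toSpace v = EuclideanSpace.single a.1 (if a.2 then (-1 : ℝ) else 1) := by
      ext i
      rw [hva]
      rcases a with ⟨j, b⟩
      by_cases hij : i = j
      · subst hij; cases b <;> simp [toSpace, unitStep]
      · cases b <;> simp [toSpace, unitStep, hij]
    rw [dist_eq_norm, ← smul_sub, h3, norm_smul, PiLp.norm_single]
    cases a.2 <;> simp [abs_of_pos hL0]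
  refine (h1.trans_eq h2).trans_lt ?_
  have h4 : 0 < 1 / δ := by positivity
  have h5 : 1 / δ < L := lt_of_lt_of_le (by rw [div_lt_div_iff_of_pos_right hδ]; norm_num) hL
  rw [← one_div]
  exact (one_div_lt hL0 hδ).2 h5

/-- A bounded open rectangle (a product of open intervals, in any position). -/
def IsOpenRectangle {d : ℕ} (D : Set (EuclideanSpace ℝ (Fin d))) : Prop :=
  ∃ a b : Fin d → ℝ, (∀ i, a i < b i) ∧
    ∃ φ : EuclideanSpace ℝ (Fin d) ≃ᵃⁱ[ℝ] EuclideanSpace ℝ (Fin d),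
      D = φ '' {x | ∀ i, a i < x i ∧ x i < b i}

/-- `Γ` is a `C²` hypersurface: an embedded `C²` submanifold of `ℝᵈ` of dimension `d - 1`. -/
def IsC2Hypersurface {d : ℕ} (Γ : Set (EuclideanSpace ℝ (Fin d))) : Prop :=
  ∀ x ∈ Γ, ∃ U : Set (EuclideanSpace ℝ (Fin d)), IsOpen U ∧ x ∈ U ∧
    ∃ g : EuclideanSpace ℝ (Fin d) → ℝ, ContDiffOn ℝ 2 g U ∧ (∀ y ∈ U, fderiv ℝ g y ≠ 0) ∧
      Γ ∩ U = {y | y ∈ U ∧ g y = 0}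

/-- The domains under consideration: bounded open rectangles, and bounded connected open sets
whose boundary is a `C²` submanifold. -/
def IsAdmissibleDomain {d : ℕ} (D : Set (EuclideanSpace ℝ (Fin d))) : Prop :=
  IsOpenRectangle D ∨
    (IsOpen D ∧ IsConnected D ∧ Bornology.IsBounded D ∧ IsC2Hypersurface (frontier D))

/-! ### The process

`S` is the set of sites, `M` the number of particles, and `τ w` the temperature at the lattice
point `w` (only its values at the points of the bath matter). -/

/-- A state consists of the site energies `(ξ_v)`, the particle energies `(η_i)` and the particle
positions `(X_i)`. -/
abbrev State {d : ℕ} (S : Set (Fin d → ℤ)) (M : ℕ) : Type :=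
  (S → ℝ≥0) × (Fin M → ℝ≥0) × (Fin M → S)

/-- The lattice point to which particle `k` tries to jump when it chooses the direction `a`. -/
def target {d : ℕ} {S : Set (Fin d → ℤ)} {M : ℕ} (x : State S M) (k : Fin M)
    (a : Fin d × Bool) : Fin d → ℤ :=
  (x.2.2 k : Fin d → ℤ) + unitStep a

/-- The sum of the energies of particle `k` and of the site at which it is located. -/
def pooled {d : ℕ} {S : Set (Fin d → ℤ)} {M : ℕ} (x : State S M) (k : Fin M) : ℝ≥0 :=
  x.1 (x.2.2 k) + x.2.1 k

/-- The state after particle `k` has left the fraction `p` of the pooled energy at its site,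
taken the remaining energy, and jumped to the site `w`. -/
def jumpInside {d : ℕ} {S : Set (Fin d → ℤ)} {M : ℕ} (x : State S M) (k : Fin M) (w : S)
    (p : ℝ) : State S M :=
  (Function.update x.1 (x.2.2 k) (p.toNNReal * pooled x k),
    Function.update x.2.1 k ((1 - p).toNNReal * pooled x k),
    Function.update x.2.2 k w)

/-- The state after particle `k` has left the fraction `p` of the pooled energy at its site,
jumped to the bath, and returned to its site with the energy `e`. -/
def jumpBath {d : ℕ} {S : Set (Fin d → ℤ)} {M : ℕ} (x : State S M) (k : Fin M)
    (p e : ℝ) : State S M :=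
  (Function.update x.1 (x.2.2 k) (p.toNNReal * pooled x k),
    Function.update x.2.1 k e.toNNReal,
    x.2.2)

open Classical in
/-- The infinitesimal generator `G = G₁ + G₂` of the process. The sum over the neighbours `w` of
the position of particle `k` is written as a sum over the `2d` directions. -/
def generator {d : ℕ} (S : Set (Fin d → ℤ)) (τ : (Fin d → ℤ) → ℝ) (M : ℕ)
    (f : State S M → ℝ) (x : State S M) : ℝ :=
  (∑ k, 1 / (2 * d : ℝ) * ∑ a, if h : target x k a ∈ S then
      ∫ p in Set.Icc (0 : ℝ) 1, (f (jumpInside x k ⟨target x k a, h⟩ p) - f x) else 0) +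
  ∑ k, 1 / (2 * d : ℝ) * ∑ a, if target x k a ∈ bath S then
      ∫ p in Set.Icc (0 : ℝ) 1, ∫ e in Set.Ioi (0 : ℝ),
        (τ (target x k a))⁻¹ * Real.exp (-(e * (τ (target x k a))⁻¹)) *
          (f (jumpBath x k p e) - f x)
      else 0

open Classical in
/-- The law of the state right after the clock of particle `k` has rung in the state `x`, given
that the particle chooses the direction `a`. (A point outside `S` all of whose neighbours are in
`S` belongs neither to the domain nor to the bath; nothing happens if it is chosen.) -/
def ringLaw {d : ℕ} (S : Set (Fin d → ℤ)) (τ : (Fin d → ℤ) → ℝ) {M : ℕ} (k : Fin M)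
    (a : Fin d × Bool) (x : State S M) : Measure (State S M) :=
  if h : target x k a ∈ S then
    (volume.restrict (Set.Icc (0 : ℝ) 1)).map (jumpInside x k ⟨target x k a, h⟩)
  else if target x k a ∈ bath S then
    ((volume.restrict (Set.Icc (0 : ℝ) 1)).prod (expMeasure (τ (target x k a))⁻¹)).map
      fun q => jumpBath x k q.1 q.2
  else Measure.dirac x

theorem measurable_update_of {ι α : Type*} [DecidableEq ι] [MeasurableSpace α] (i : ι)
    {f : α → ι → ℝ≥0} {g : α → ℝ≥0} (hf : Measurable f) (hg : Measurable g) :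
    Measurable fun q => Function.update (f q) i (g q) := by
  refine measurable_pi_iff.2 fun j => ?_
  by_cases h : j = i
  · subst h; simpa using hg
  · simpa [Function.update_of_ne h] using measurable_pi_iff.1 hf j

theorem measurable_jumpInside {d : ℕ} {S : Set (Fin d → ℤ)} {M : ℕ} (k : Fin M) (w : S)
    (X : Fin M → S) :
    Measurable fun q : ((S → ℝ≥0) × (Fin M → ℝ≥0)) × ℝ =>
      jumpInside (q.1.1, q.1.2, X) k w q.2 := by
  have h1 : Measurable fun q : ((S → ℝ≥0) × (Fin M → ℝ≥0)) × ℝ => q.1.1 (X k) + q.1.2 k := by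
    fun_prop
  unfold jumpInside pooled
  exact (measurable_update_of _ (by fun_prop) (by fun_prop)).prodMk
    ((measurable_update_of _ (by fun_prop) (by fun_prop)).prodMk
      (measurable_const (a := Function.update X k w)))

theorem measurable_jumpBath {d : ℕ} {S : Set (Fin d → ℤ)} {M : ℕ} (k : Fin M)
    (X : Fin M → S) :
    Measurable fun q : ((S → ℝ≥0) × (Fin M → ℝ≥0)) × ℝ × ℝ =>
      jumpBath (q.1.1, q.1.2, X) k q.2.1 q.2.2 := by
  have h1 : Measurable fun q : ((S → ℝ≥0) × (Fin M → ℝ≥0)) × ℝ × ℝ =>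
      q.1.1 (X k) + q.1.2 k := by
    fun_prop
  unfold jumpBath pooled
  exact (measurable_update_of _ (by fun_prop) (by fun_prop)).prodMk
    ((measurable_update_of _ (by fun_prop) (by fun_prop)).prodMk (measurable_const (a := X)))

theorem measurable_map_of_uncurry {α β γ : Type*} [MeasurableSpace α] [MeasurableSpace β]
    [MeasurableSpace γ] (μ : Measure β) [SFinite μ] {F : α → β → γ}
    (hF : Measurable fun q : α × β => F q.1 q.2) : Measurable fun x => μ.map (F x) := by
  refine Measure.measurable_of_measurable_coe _ fun s hs => ?_
  have h : ∀ x, (μ.map (F x)) s = μ (Prod.mk x ⁻¹' ((fun q : α × β => F q.1 q.2) ⁻¹' s)) :=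
    fun x => Measure.map_apply (hF.comp measurable_prodMk_left) hs
  simp_rw [h]
  exact measurable_measure_prodMk_left (hF hs)

instance sFinite_expMeasure (r : ℝ) : SFinite (expMeasure r) := by
  unfold expMeasure gammaMeasure; infer_instance

theorem measurable_ringLaw {d : ℕ} (S : Set (Fin d → ℤ)) (τ : (Fin d → ℤ) → ℝ) {M : ℕ}
    (k : Fin M) (a : Fin d × Bool) : Measurable (ringLaw S τ k a) := by
  have key : Measurable fun q : ((S → ℝ≥0) × (Fin M → ℝ≥0)) × (Fin M → S) =>
      ringLaw S τ k a (q.1.1, q.1.2, q.2) := by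
    refine measurable_from_prod_countable_left fun X => ?_
    by_cases h : (X k : Fin d → ℤ) + unitStep a ∈ S
    · have e : (fun y : (S → ℝ≥0) × (Fin M → ℝ≥0) => ringLaw S τ k a (y.1, y.2, X)) =
          fun y => (volume.restrict (Set.Icc (0 : ℝ) 1)).map
            ((fun (y : (S → ℝ≥0) × (Fin M → ℝ≥0)) (p : ℝ) =>
              jumpInside (y.1, y.2, X) k ⟨_, h⟩ p) y) :=
        funext fun y => dif_pos h
      exact e ▸ measurable_map_of_uncurry _ (measurable_jumpInside k ⟨_, h⟩ X)
    · by_cases h' : (X k : Fin d → ℤ) + unitStep a ∈ bath S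
      · have e : (fun y : (S → ℝ≥0) × (Fin M → ℝ≥0) => ringLaw S τ k a (y.1, y.2, X)) =
            fun y => ((volume.restrict (Set.Icc (0 : ℝ) 1)).prod
              (expMeasure (τ ((X k : Fin d → ℤ) + unitStep a))⁻¹)).map
              ((fun (y : (S → ℝ≥0) × (Fin M → ℝ≥0)) (q : ℝ × ℝ) =>
                jumpBath (y.1, y.2, X) k q.1 q.2) y) :=
          funext fun y => (dif_neg h).trans (if_pos h')
        exact e ▸ measurable_map_of_uncurry _ (measurable_jumpBath k X)
      · have e : (fun y : (S → ℝ≥0) × (Fin M → ℝ≥0) => ringLaw S τ k a (y.1, y.2, X)) =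
            fun y => Measure.dirac ((y.1, y.2, X) : State S M) :=
          funext fun y => (dif_neg h).trans (if_neg h')
        exact e ▸ Measure.measurable_dirac.comp (by fun_prop)
  have h2 : Measurable fun x : State S M => ((x.1, x.2.1), x.2.2) := by fun_prop
  exact key.comp h2

/-- The transition kernel of the chain that records the state after each ring of a clock: the
particle whose clock rings and the direction that it chooses are uniformly distributed. -/
def ringKernel {d : ℕ} (S : Set (Fin d → ℤ)) (τ : (Fin d → ℤ) → ℝ) (M : ℕ) :
    Kernel (State S M) (State S M) where
  toFun x := ∑ k, ∑ a, ((2 * d * M : ℕ) : ℝ≥0∞)⁻¹ • ringLaw S τ k a x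
  measurable' := by
    refine Measure.measurable_of_measurable_coe _ fun s hs => ?_
    simp only [Measure.finsetSum_apply, Measure.smul_apply, smul_eq_mul]
    have h := fun k a => (Measure.measurable_coe hs).comp (measurable_ringLaw S τ (M := M) k a)
    exact Finset.measurable_sum _ fun k _ => Finset.measurable_sum _ fun a _ =>
      (h k a).const_mul _

/-- The transition probabilities of the process `X_t`: the `M` independent rate-one clocks ring
altogether a Poisson number of times with mean `M t` during a time interval of length `t`. -/
def transition {d : ℕ} (S : Set (Fin d → ℤ)) (τ : (Fin d → ℤ) → ℝ) (M : ℕ) (t : ℝ≥0) :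
    Kernel (State S M) (State S M) where
  toFun x := (poissonMeasure (M * t)).bind fun n => (ringKernel S τ M ^ n) x
  measurable' := by
    refine Measure.measurable_of_measurable_coe _ fun s hs => ?_
    simp only [Measure.bind_apply hs Measurable.of_discrete.aemeasurable]
    refine Measurable.lintegral_prod_right' (f := fun q : State S M × ℕ =>
      (ringKernel S τ M ^ q.2) q.1 s) ?_
    exact measurable_from_prod_countable_left fun n =>
      Kernel.measurable_coe (ringKernel S τ M ^ n) hs

/-! ### The process with the transition probabilities `transition` has the generator `generator` -/

theorem isProbabilityMeasure_ringLaw {d : ℕ} {S : Set (Fin d → ℤ)} {τ : (Fin d → ℤ) → ℝ}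
    (hτ : ∀ w ∈ bath S, 0 < τ w) {M : ℕ} (k : Fin M) (a : Fin d × Bool) (x : State S M) :
    IsProbabilityMeasure (ringLaw S τ k a x) := by
  have hI : IsProbabilityMeasure ((volume : Measure ℝ).restrict (Set.Icc (0 : ℝ) 1)) := ⟨by simp⟩
  unfold ringLaw
  split_ifs with h h'
  · refine Measure.isProbabilityMeasure_map (Measurable.aemeasurable ?_)
    exact (measurable_jumpInside k ⟨_, h⟩ x.2.2).comp (measurable_prodMk_left (x := (x.1, x.2.1)))
  · have := isProbabilityMeasure_expMeasure (inv_pos.2 (hτ _ h'))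
    refine Measure.isProbabilityMeasure_map (Measurable.aemeasurable ?_)
    exact (measurable_jumpBath k x.2.2).comp (measurable_prodMk_left (x := (x.1, x.2.1)))
  · infer_instance

theorem isMarkovKernel_ringKernel {d : ℕ} (hd : 0 < d) {S : Set (Fin d → ℤ)}
    {τ : (Fin d → ℤ) → ℝ} (hτ : ∀ w ∈ bath S, 0 < τ w) {M : ℕ} (hM : 0 < M) :
    IsMarkovKernel (ringKernel S τ M) := by
  refine ⟨fun x => ⟨?_⟩⟩
  change (∑ k, ∑ a, ((2 * d * M : ℕ) : ℝ≥0∞)⁻¹ • ringLaw S τ k a x) Set.univ = 1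
  have h := fun (k : Fin M) a => (isProbabilityMeasure_ringLaw hτ k a x).measure_univ
  simp only [Measure.finsetSum_apply, Measure.smul_apply, h, smul_eq_mul, mul_one,
    Finset.sum_const, Finset.card_univ, Fintype.card_prod, Fintype.card_fin, Fintype.card_bool,
    nsmul_eq_mul]
  rw [← mul_assoc, ← Nat.cast_mul, show M * (d * 2) = 2 * d * M by ring]
  exact ENNReal.mul_inv_cancel (by simp; omega) (ENNReal.natCast_ne_top _)

theorem isMarkovKernel_pow {α : Type*} [MeasurableSpace α] (κ : Kernel α α) [IsMarkovKernel κ]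
    (n : ℕ) : IsMarkovKernel (κ ^ n) := by
  induction n with
  | zero => exact (inferInstance : IsMarkovKernel (Kernel.id : Kernel α α))
  | succ n ih =>
    rw [_root_.pow_succ]
    exact (inferInstance : IsMarkovKernel ((κ ^ n) ∘ₖ κ))

theorem transition_apply {d : ℕ} (S : Set (Fin d → ℤ)) (τ : (Fin d → ℤ) → ℝ) (M : ℕ) (t : ℝ≥0)
    (x : State S M) {A : Set (State S M)} (hA : MeasurableSet A) :
    transition S τ M t x A = ∫⁻ n, (ringKernel S τ M ^ n) x A ∂poissonMeasure (M * t) :=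
  Measure.bind_apply hA Measurable.of_discrete.aemeasurable

theorem isMarkovKernel_transition {d : ℕ} (hd : 0 < d) {S : Set (Fin d → ℤ)}
    {τ : (Fin d → ℤ) → ℝ} (hτ : ∀ w ∈ bath S, 0 < τ w) {M : ℕ} (hM : 0 < M) (t : ℝ≥0) :
    IsMarkovKernel (transition S τ M t) := by
  have := isMarkovKernel_ringKernel hd hτ hM
  have h := isMarkovKernel_pow (ringKernel S τ M)
  refine ⟨fun x => ⟨?_⟩⟩
  rw [transition_apply _ _ _ _ _ MeasurableSet.univ]
  simp

/-- The semigroup property, at time zero. -/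
theorem transition_zero {d : ℕ} (S : Set (Fin d → ℤ)) (τ : (Fin d → ℤ) → ℝ) (M : ℕ) :
    transition S τ M 0 = Kernel.id := by
  ext x A hA
  have h0 : poissonMeasure 0 = Measure.dirac 0 := by
    ext s hs
    rw [poissonMeasure, Measure.sum_apply _ hs, tsum_eq_single 0]
    · simp
    · intro n hn; simp [hn]
  rw [transition_apply _ _ _ _ _ hA, mul_zero, h0, lintegral_dirac]
  rfl

/-- The semigroup property (Chapman-Kolmogorov equation). -/
theorem transition_add {d : ℕ} (hd : 0 < d) {S : Set (Fin d → ℤ)}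
    {τ : (Fin d → ℤ) → ℝ} (hτ : ∀ w ∈ bath S, 0 < τ w) {M : ℕ} (hM : 0 < M) (s t : ℝ≥0) :
    transition S τ M (s + t) = transition S τ M t ∘ₖ transition S τ M s := by
  have := isMarkovKernel_ringKernel hd hτ hM
  have h := isMarkovKernel_pow (ringKernel S τ M)
  ext x A hA
  rw [transition_apply _ _ _ _ _ hA, mul_add, ← poissonMeasure_conv_poissonMeasure,
    Measure.lintegral_conv (by fun_prop), Kernel.comp_apply' _ _ _ hA]
  change _ = ∫⁻ y, transition S τ M t y A ∂((poissonMeasure (M * s)).bind fun n =>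
    (ringKernel S τ M ^ n) x)
  rw [Measure.lintegral_bind Measurable.of_discrete.aemeasurable
    (Kernel.measurable_coe _ hA).aemeasurable]
  refine lintegral_congr fun m => ?_
  simp_rw [transition_apply _ _ _ _ _ hA, Kernel.pow_add_apply_eq_lintegral _ m _ x hA]
  refine lintegral_lintegral_swap (Measurable.aemeasurable ?_)
  exact measurable_from_prod_countable_right fun n =>
    Kernel.measurable_coe (ringKernel S τ M ^ n) hA

theorem integrable_of_bounded {α : Type*} [MeasurableSpace α] (μ : Measure α) [IsFiniteMeasure μ]
    {f : α → ℝ} (hf : Measurable f) {C : ℝ} (hC : ∀ y, |f y| ≤ C) : Integrable f μ :=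
  Integrable.of_bound hf.aestronglyMeasurable C (Eventually.of_forall hC)

open Classical in
/-- The generator is the rate `M` times the expected change at a ring of a clock. -/
theorem generator_eq {d : ℕ} (hd : 0 < d) {S : Set (Fin d → ℤ)}
    {τ : (Fin d → ℤ) → ℝ} (hτ : ∀ w ∈ bath S, 0 < τ w) {M : ℕ} (hM : 0 < M)
    {f : State S M → ℝ} (hf : Measurable f) {C : ℝ} (hC : ∀ y, |f y| ≤ C) (x : State S M) :
    generator S τ M f x = M * (∫ y, f y ∂ringKernel S τ M x - f x) := by
  have hP := fun (k : Fin M) a => isProbabilityMeasure_ringLaw hτ k a x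
  have hI : IsProbabilityMeasure ((volume : Measure ℝ).restrict (Set.Icc (0 : ℝ) 1)) := ⟨by simp⟩
  have hne : ((2 * d * M : ℕ) : ℝ≥0∞) ≠ 0 := by simp; omega
  have e1 : ∫ y, f y ∂ringKernel S τ M x =
      ∑ k, ∑ a, (2 * d * M : ℝ)⁻¹ * ∫ y, f y ∂ringLaw S τ k a x := by
    change ∫ y, f y ∂(∑ k, ∑ a, ((2 * d * M : ℕ) : ℝ≥0∞)⁻¹ • ringLaw S τ k a x) = _
    have hi : ∀ (k : Fin M) a, Integrable f (((2 * d * M : ℕ) : ℝ≥0∞)⁻¹ • ringLaw S τ k a x) :=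
      fun k a => (integrable_of_bounded _ hf hC).smul_measure (ENNReal.inv_ne_top.2 hne)
    rw [integral_finsetSum_measure fun k _ => integrable_finsetSum_measure.2 fun a _ => hi k a]
    refine Finset.sum_congr rfl fun k _ => ?_
    rw [integral_finsetSum_measure fun a _ => hi k a]
    refine Finset.sum_congr rfl fun a _ => ?_
    rw [integral_smul_measure]
    simp [ENNReal.toReal_mul]
  have e2 : ∀ (k : Fin M) a, ∫ y, f y ∂ringLaw S τ k a x - f x =
      (if h : target x k a ∈ S then
        ∫ p in Set.Icc (0 : ℝ) 1, (f (jumpInside x k ⟨target x k a, h⟩ p) - f x) else 0) +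
      if target x k a ∈ bath S then
        ∫ p in Set.Icc (0 : ℝ) 1, ∫ e in Set.Ioi (0 : ℝ),
          (τ (target x k a))⁻¹ * Real.exp (-(e * (τ (target x k a))⁻¹)) *
            (f (jumpBath x k p e) - f x)
        else 0 := by
    intro k a
    by_cases h : target x k a ∈ S
    · have h' : target x k a ∉ bath S := fun h' => h'.2 h
      have hm : Measurable (jumpInside x k ⟨target x k a, h⟩) :=
        (measurable_jumpInside k ⟨_, h⟩ x.2.2).comp (measurable_prodMk_left (x := (x.1, x.2.1)))
      have hi : Integrable (fun p => f (jumpInside x k ⟨target x k a, h⟩ p))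
          (volume.restrict (Set.Icc (0 : ℝ) 1)) :=
        integrable_of_bounded _ (hf.comp hm) fun p => hC _
      rw [dif_pos h, if_neg h', add_zero, ringLaw, dif_pos h,
        integral_map hm.aemeasurable hf.aestronglyMeasurable,
        integral_sub hi (integrable_const _)]
      simp
    · by_cases h' : target x k a ∈ bath S
      · have hβ := inv_pos.2 (hτ _ h')
        have := isProbabilityMeasure_expMeasure hβ
        have hm : Measurable fun q : ℝ × ℝ => jumpBath x k q.1 q.2 :=
          (measurable_jumpBath k x.2.2).comp (measurable_prodMk_left (x := (x.1, x.2.1)))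
        rw [dif_neg h, if_pos h', zero_add, ringLaw, dif_neg h, if_pos h',
          integral_map hm.aemeasurable hf.aestronglyMeasurable]
        set β := (τ (target x k a))⁻¹
        have hi₀ : Integrable (fun q : ℝ × ℝ => f (jumpBath x k q.1 q.2))
            ((volume.restrict (Set.Icc (0 : ℝ) 1)).prod (expMeasure β)) :=
          integrable_of_bounded _ (hf.comp hm) fun p => hC _
        have hi : Integrable (fun q : ℝ × ℝ => f (jumpBath x k q.1 q.2) - f x)
            ((volume.restrict (Set.Icc (0 : ℝ) 1)).prod (expMeasure β)) :=
          hi₀.sub (integrable_const _)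
        have e3 : ∫ q, f (jumpBath x k q.1 q.2) ∂((volume.restrict (Set.Icc (0 : ℝ) 1)).prod
            (expMeasure β)) - f x = ∫ q, (f (jumpBath x k q.1 q.2) - f x)
              ∂((volume.restrict (Set.Icc (0 : ℝ) 1)).prod (expMeasure β)) := by
          rw [integral_sub hi₀ (integrable_const _)]
          simp
        rw [e3, integral_prod _ hi]
        refine integral_congr_ae (Eventually.of_forall fun p => ?_)
        change ∫ e, (f (jumpBath x k p e) - f x) ∂(volume.withDensity (exponentialPDF β)) = _
        rw [integral_withDensity_eq_integral_toReal_smul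
          (show Measurable (exponentialPDF β) from
            (measurable_exponentialPDFReal β).ennreal_ofReal)
          (Eventually.of_forall fun _ => ENNReal.ofReal_lt_top)]
        beta_reduce
        rw [← integral_Ici_eq_integral_Ioi, ← integral_indicator measurableSet_Ici]
        refine integral_congr_ae (Eventually.of_forall fun e => ?_)
        by_cases he : 0 ≤ e
        · have : (0 : ℝ) ≤ β * Real.exp (-(β * e)) := by positivity
          simp [Set.indicator, he, exponentialPDF_of_nonneg he, ENNReal.toReal_ofReal this,
            mul_comm e β]
        · simp [Set.indicator, he, exponentialPDF_of_neg (not_le.1 he)]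
      · rw [dif_neg h, if_neg h', ringLaw, dif_neg h, if_neg h', integral_dirac]
        simp
  have hd' : (d : ℝ) ≠ 0 := by positivity
  have hM' : (M : ℝ) ≠ 0 := by positivity
  have e4 : f x = ∑ k : Fin M, ∑ a : Fin d × Bool, (2 * d * M : ℝ)⁻¹ * f x := by
    simp only [Finset.sum_const, Finset.card_univ, Fintype.card_prod, Fintype.card_fin,
      Fintype.card_bool, nsmul_eq_mul]
    push_cast
    field_simp
  have e5 : ∫ y, f y ∂ringKernel S τ M x - f x =
      (∑ k, ∑ a, (2 * d * M : ℝ)⁻¹ * ∫ y, f y ∂ringLaw S τ k a x) -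
        ∑ k : Fin M, ∑ a : Fin d × Bool, (2 * d * M : ℝ)⁻¹ * f x := by
    rw [← e4, e1]
  rw [e5, generator, ← Finset.sum_add_distrib, ← Finset.sum_sub_distrib, Finset.mul_sum]
  refine Finset.sum_congr rfl fun k _ => ?_
  rw [← mul_add, ← Finset.sum_add_distrib, ← Finset.sum_sub_distrib, Finset.mul_sum,
    Finset.mul_sum]
  refine Finset.sum_congr rfl fun a _ => ?_
  rw [← e2]
  field_simp

/-- The transition semigroup has the infinitesimal generator `generator`: for every bounded
measurable `f`, the quotient `(P_t f - f) / t` tends to `G f` uniformly, as `t` tends to zero. -/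
theorem transition_generator {d : ℕ} (hd : 0 < d) {S : Set (Fin d → ℤ)}
    {τ : (Fin d → ℤ) → ℝ} (hτ : ∀ w ∈ bath S, 0 < τ w) {M : ℕ} (hM : 0 < M)
    {f : State S M → ℝ} (hf : Measurable f) {C : ℝ} (hC : ∀ y, |f y| ≤ C) (t : ℝ≥0)
    (x : State S M) :
    |∫ y, f y ∂transition S τ M t x - f x - t * generator S τ M f x| ≤ 3 * C * (M * t) ^ 2 := by
  have := isMarkovKernel_ringKernel hd hτ hM
  have := isMarkovKernel_transition hd hτ hM t
  have hK := isMarkovKernel_pow (ringKernel S τ M)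
  set r : ℝ≥0 := M * t with hr
  set A : ℕ → ℝ := fun n => ∫ y, f y ∂(ringKernel S τ M ^ n) x with hA
  have hAC : ∀ n, |A n| ≤ C := fun n => by
    have := norm_integral_le_of_norm_le_const (μ := (ringKernel S τ M ^ n) x)
      (Eventually.of_forall (p := fun y => ‖f y‖ ≤ C) hC)
    simpa using this
  have hA0 : A 0 = f x := by
    change ∫ y, f y ∂(Kernel.id : Kernel (State S M) (State S M)) x = f x
    rw [Kernel.id_apply, integral_dirac]
  have hA1 : A 1 = ∫ y, f y ∂ringKernel S τ M x := by simp [hA]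
  have hint : ∫ y, f y ∂transition S τ M t x = ∫ n, A n ∂poissonMeasure r := by
    let η : Kernel ℕ (State S M) := ⟨fun n => (ringKernel S τ M ^ n) x, Measurable.of_discrete⟩
    have hfi : Integrable f ((poissonMeasure r).bind η) := by
      have : IsFiniteMeasure ((poissonMeasure r).bind η) :=
        inferInstanceAs (IsFiniteMeasure (transition S τ M t x))
      exact integrable_of_bounded _ hf hC
    exact Kernel.integral_comp (κ := Kernel.const Unit (poissonMeasure r)) (η := η) (a := ()) hfi
  have hG : (t : ℝ) * generator S τ M f x = r * (A 1 - A 0) := by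
    rw [generator_eq hd hτ hM hf hC, hA1, hA0, hr]
    push_cast
    ring
  rw [hint, hG, ← hA0]
  have hsum := hasSum_integral_poissonMeasure
    (integrable_of_bounded (poissonMeasure r) (f := A) Measurable.of_discrete hAC)
  have hone := hasSum_one_poissonMeasure r
  have hsum2 := (hasSum_nat_add_iff' 2).2 hsum
  have hone2 := (hasSum_nat_add_iff' 2).2 hone
  have hcn : ∀ n : ℕ, 0 ≤ Real.exp (-r) * (r : ℝ) ^ n / n.factorial := fun n => by positivity
  have up := hasSum_le (fun n => by
    rw [smul_eq_mul, mul_comm C]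
    exact mul_le_mul_of_nonneg_left (abs_le.1 (hAC (n + 2))).2 (hcn (n + 2)))
    hsum2 (hone2.mul_left C)
  have lo := hasSum_le (fun n => by
    rw [smul_eq_mul, mul_comm (-C)]
    exact mul_le_mul_of_nonneg_left (abs_le.1 (hAC (n + 2))).1 (hcn (n + 2)))
    (hone2.mul_left (-C)) hsum2
  simp only [Finset.sum_range_succ, Finset.sum_range_zero, pow_zero, pow_one, Nat.factorial,
    smul_eq_mul, Nat.cast_one, mul_one, div_one, zero_add] at up lo
  have hr0 : (0 : ℝ) ≤ r := r.2
  have hE1 : 1 - (r : ℝ) ≤ Real.exp (-r) := by linarith [Real.add_one_le_exp (-(r : ℝ))]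
  have hE2 : Real.exp (-r) ≤ 1 - (r : ℝ) + (r : ℝ) ^ 2 := by
    have h1 : Real.exp (-(r : ℝ)) * (1 + r) ≤ 1 := by
      have h2 := Real.add_one_le_exp (r : ℝ)
      calc Real.exp (-(r : ℝ)) * (1 + r) ≤ Real.exp (-(r : ℝ)) * Real.exp r :=
            mul_le_mul_of_nonneg_left (by linarith) (Real.exp_pos _).le
        _ = 1 := by rw [← Real.exp_add]; simp
    have h3 : Real.exp (-(r : ℝ)) * (1 + r) ≤ (1 - (r : ℝ) + (r : ℝ) ^ 2) * (1 + r) := by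
      nlinarith [pow_nonneg hr0 3]
    exact le_of_mul_le_mul_right h3 (by linarith)
  have hE3 : Real.exp (-r) ≤ 1 := Real.exp_le_one_iff.2 (by simp)
  have hC0 : 0 ≤ C := (abs_nonneg _).trans (hAC 0)
  generalize Real.exp (-(r : ℝ)) = E at *
  have hrM : ((M : ℝ) * t) = r := by rw [hr]; push_cast; ring
  rw [hrM]
  generalize ∫ n, A n ∂poissonMeasure r = I at *
  generalize hρ : (r : ℝ) = ρ at *
  have t1 : |I - (E * A 0 + E * ρ * A 1)| ≤ C * ρ ^ 2 := by
    have h1 : 1 - (E + E * ρ) ≤ ρ ^ 2 := by nlinarith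
    have h2 := mul_le_mul_of_nonneg_left h1 hC0
    exact abs_le.2 ⟨by linarith, by linarith⟩
  have t2 : |(E - 1 + ρ) * A 0| ≤ C * ρ ^ 2 := by
    rw [abs_mul, mul_comm C]
    exact mul_le_mul (abs_le.2 ⟨by nlinarith, by linarith⟩) (hAC 0) (abs_nonneg _) (sq_nonneg _)
  have t3 : |(E - 1) * ρ * A 1| ≤ C * ρ ^ 2 := by
    rw [abs_mul, mul_comm C]
    exact mul_le_mul (abs_le.2 ⟨by nlinarith, by nlinarith⟩) (hAC 1) (abs_nonneg _) (sq_nonneg _)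
  have e : I - A 0 - ρ * (A 1 - A 0) =
      (I - (E * A 0 + E * ρ * A 1)) + (E - 1 + ρ) * A 0 + (E - 1) * ρ * A 1 := by ring
  rw [e]
  have := abs_add_three (I - (E * A 0 + E * ρ * A 1)) ((E - 1 + ρ) * A 0) ((E - 1) * ρ * A 1)
  linarith

/-- Convergence in total variation, as time tends to infinity, of a family of probability
measures. (It implies weak convergence.) -/
def TendstoInTotalVariation {α : Type*} [MeasurableSpace α] (ν : ℝ≥0 → Measure α)
    (μ : Measure α) : Prop :=
  ∀ ε : ℝ, 0 < ε → ∃ t₀ : ℝ≥0, ∀ t, t₀ ≤ t → ∀ A, MeasurableSet A →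
    |(ν t).real A - μ.real A| ≤ ε

end EnergyExchange

end

open EnergyExchange

noncomputable section

namespace EnergyExchange

/-! ### Harris' theorem -/

section Harris

variable {α : Type*} [MeasurableSpace α]

/-! The total energy `V` is a Lyapunov function with small sublevel sets, so Harris' theorem applies
to the time-one kernel, and the semigroup property extends its conclusion to all times.

Drift (`exists_drift`): a jump inside the domain conserves `V`; a jump to the bath gives up a
fraction of the pooled energy and brings in an exponential variable of bounded mean. The energy of
any single site or particle can be carried to the bath along an itinerary of fixed length which,
with positive probability, preserves a fixed fraction of it (`Drained.all`). Hence a fixed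
proportion of each coordinate is lost in the mean, and averaging over the coordinates gives `P V ≤ γ
V + K` with `γ < 1`.

Minorization (`exists_le_transition`): from bounded energies the chain reaches, with probability
bounded below, a box in which all particles sit at a site `v₀` next to the bath and all energies lie
in `[r⁻¹, r]` (`Reach.gather`). From this box the initial energies are forgotten one after the other
(`Minorized.all`). An exchange is parametrized by the energy left at the site instead of the
fraction `p`, so two different states can be given the same site energy; a jump to the bath makes
the particle forget its energy too. One particle treats the sites from the farthest to the nearest
to `v₀`, so that its walks disturb only sites that are treated later; at the end all particles
exchange with the bath. The numbers of rings depend on the initial positions, but each number of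
rings in unit time has positive probability.

Harris' theorem (`exists_unique_invariant_of_drift`) rests on the contraction of a weighted
oscillation seminorm (`exists_contraction`). It makes the laws of the chain Cauchy in total
variation; their limit is the invariant measure. -/

theorem exists_abs_sub_le {α : Type*} {φ w : α → ℝ} (h : ∀ x y, |φ x - φ y| ≤ w x + w y) :
    ∃ c, ∀ x, |φ x - c| ≤ w x := by
  rcases isEmpty_or_nonempty α with hα | hα
  · exact ⟨0, fun x => (hα.false x).elim⟩
  have h1 : ∀ x y, φ x - w x ≤ φ y + w y := fun x y => by
    linarith [(abs_le.1 (h x y)).2]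
  -- The intervals `[φ x - w x, φ x + w x]` intersect pairwise, so the supremum of the left ends is
  -- a common point.
  refine ⟨⨆ x, (φ x - w x), fun x => abs_le.2 ⟨?_, ?_⟩⟩
  · have := ciSup_le fun y => h1 y x
    linarith
  · have hb : BddAbove (Set.range fun x => φ x - w x) :=
      ⟨φ x + w x, by rintro _ ⟨y, rfl⟩; exact h1 y x⟩
    have := le_ciSup hb x
    linarith

theorem integral_le_integral_of_measure_le {μ ν : Measure α} (h : ν ≤ μ) {f : α → ℝ}
    (hf : Integrable f μ) (h0 : ∀ x, 0 ≤ f x) : ∫ x, f x ∂ν ≤ ∫ x, f x ∂μ :=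
  integral_mono_measure h (Eventually.of_forall h0) hf

/-- If two probability measures dominate a common measure of mass `a`, then the integrals of a
function that is small with respect to the weight `w` differ by less than the weights do. -/
theorem abs_integral_sub_le_of_common_part {μ₁ μ₂ ν : Measure α} [IsFiniteMeasure μ₁]
    [IsFiniteMeasure μ₂] (h₁ : ν ≤ μ₁) (h₂ : ν ≤ μ₂) {φ w : α → ℝ} {a : ℝ}
    (hw₁ : Integrable w μ₁) (hw₂ : Integrable w μ₂) (hφ₁ : Integrable φ μ₁)
    (hφ₂ : Integrable φ μ₂) (hφ : ∀ x, |φ x| ≤ w x) (ha : a ≤ ∫ x, w x ∂ν) :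
    |∫ x, φ x ∂μ₁ - ∫ x, φ x ∂μ₂| ≤ ∫ x, w x ∂μ₁ + ∫ x, w x ∂μ₂ - 2 * a := by
  -- This is the bound of `∫ φ` by `∫ w` for the positive measure `μ - ν`, obtained by integrating
  -- the nonnegative functions `w - φ` and `w + φ`. In the difference of the two integrals the
  -- contribution of `ν` cancels.
  have key : ∀ μ : Measure α, ν ≤ μ → Integrable w μ → Integrable φ μ →
      |∫ x, φ x ∂μ - ∫ x, φ x ∂ν| ≤ ∫ x, w x ∂μ - a := by
    intro μ h hw hf
    have hwν := hw.mono_measure h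
    have hfν := hf.mono_measure h
    have e1 := integral_le_integral_of_measure_le h (hw.sub hf)
      (fun x => by have := (abs_le.1 (hφ x)).2; simpa using this)
    have e2 := integral_le_integral_of_measure_le h (hw.add hf)
      (fun x => by have := (abs_le.1 (hφ x)).1; simp only [Pi.add_apply]; linarith)
    simp only [Pi.sub_apply, Pi.add_apply] at e1 e2
    rw [integral_sub hw hf, integral_sub hwν hfν] at e1
    rw [integral_add hw hf, integral_add hwν hfν] at e2
    exact abs_le.2 ⟨by linarith, by linarith⟩
  have k₁ := abs_le.1 (key μ₁ h₁ hw₁ hφ₁)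
  have k₂ := abs_le.1 (key μ₂ h₂ hw₂ hφ₂)
  exact abs_le.2 ⟨by linarith [k₁.1, k₂.2], by linarith [k₁.2, k₂.1]⟩

/-- The contraction estimate of Hairer and Mattingly: a geometric drift condition and a
minorization on the sublevel sets of the Lyapunov function imply that the kernel contracts a
weighted oscillation seminorm. -/
theorem exists_contraction [Nonempty α] (P : Kernel α α) [IsMarkovKernel P] {V : α → ℝ}
    (hV0 : ∀ x, 0 ≤ V x) (hVi : ∀ x, Integrable V (P x)) {γ K : ℝ} (hγ0 : 0 ≤ γ) (hγ : γ < 1)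
    (hK : 0 ≤ K) (hdrift : ∀ x, ∫ y, V y ∂P x ≤ γ * V x + K)
    (hminor : ∀ R : ℝ, ∃ ν : Measure α, ν ≠ 0 ∧ ∀ x, V x ≤ R → ν ≤ P x) :
    ∃ β > 0, ∃ ρ, 0 ≤ ρ ∧ ρ < 1 ∧ ∀ φ : α → ℝ, Measurable φ → (∃ C, ∀ x, |φ x| ≤ C) →
      ∀ c, 0 ≤ c → (∀ x y, |φ x - φ y| ≤ c * (2 + β * (V x + V y))) →
      ∀ x y, |∫ z, φ z ∂P x - ∫ z, φ z ∂P y| ≤ ρ * c * (2 + β * (V x + V y)) := by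
  obtain ⟨x₀⟩ := ‹Nonempty α›
  -- Beyond `4 * K / (1 - γ)` the drift beats the constant `K`. The second entry puts `x₀` into the
  -- sublevel set, so that `ν ≤ P x₀` is finite of mass at most one.
  set R : ℝ := max (4 * K / (1 - γ) + 1) (V x₀) with hR
  obtain ⟨ν, hν0, hν⟩ := hminor R
  have hνx₀ : ν ≤ P x₀ := hν x₀ (le_max_right _ _)
  have hνf : IsFiniteMeasure ν := isFiniteMeasure_of_le _ hνx₀
  set a : ℝ := ν.real Set.univ with ha
  have ha0 : 0 < a := by
    rw [ha, measureReal_def]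
    exact ENNReal.toReal_pos (by simpa using hν0) (measure_ne_top _ _)
  have ha1 : a ≤ 1 := by
    have := ENNReal.toReal_mono (measure_ne_top _ _) (hνx₀ Set.univ)
    simpa [ha, measureReal_def] using this
  have hγ' : 0 < 1 - γ := by linarith
  have hR0 : 0 < R := lt_of_lt_of_le (by positivity) (le_max_left _ _)
  have hRK : 4 * K < R * (1 - γ) := by
    have : 4 * K / (1 - γ) < R := lt_of_lt_of_le (by linarith) (le_max_left _ _)
    rwa [div_lt_iff₀ hγ'] at this
  -- The weight is so small that the growth `2 * β * K` allowed by the drift uses up at most half of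
  -- the gain `2 * a` from the common part.
  set β : ℝ := a / (2 * (K + 1)) with hβ
  have hβ0 : 0 < β := by positivity
  have hβK : 2 * (β * K) ≤ a := by
    have h1 : β * (2 * (K + 1)) = a := by rw [hβ]; field_simp
    nlinarith
  -- In the far case `2 * ε + ε * β * W + 2 * β * K ≤ (1 - γ) * β * W` is needed for `W > R`; the
  -- three terms on the left take up at most a quarter, a quarter and a half of the right side.
  set ε : ℝ := min ((1 - γ) / 4) (β * (1 - γ) * R / 8) with hε
  have hε0 : 0 < ε := lt_min (by positivity) (by positivity)
  have hε1 : ε ≤ (1 - γ) / 4 := min_le_left _ _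
  have hε2 : ε ≤ β * (1 - γ) * R / 8 := min_le_right _ _
  refine ⟨β, hβ0, max (1 - ε) (max γ (1 - a / 2)), ?_, ?_, ?_⟩
  · exact le_trans hγ0 (le_trans (le_max_left _ _) (le_max_right _ _))
  · refine max_lt (by linarith) (max_lt hγ (by linarith))
  intro φ hφm hφb c hc hφ x y
  set ρ := max (1 - ε) (max γ (1 - a / 2)) with hρ
  have hρ1 : 1 - ε ≤ ρ := le_max_left _ _
  have hρ2 : γ ≤ ρ := le_trans (le_max_left _ _) (le_max_right _ _)
  have hρ3 : 1 - a / 2 ≤ ρ := le_trans (le_max_right _ _) (le_max_right _ _)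
  -- Centring at `s` turns the bound on the oscillation into a pointwise bound by the weight and
  -- does not change the difference of the integrals.
  obtain ⟨s, hs⟩ := exists_abs_sub_le (φ := φ) (w := fun x => c * (1 + β * V x))
    (fun x y => (hφ x y).trans_eq (by ring))
  obtain ⟨C, hC⟩ := hφb
  have hφi : ∀ x, Integrable φ (P x) := fun x => integrable_of_bounded _ hφm hC
  have hψi : ∀ x, Integrable (fun z => φ z - s) (P x) :=
    fun x => (hφi x).sub (integrable_const _)
  have hwi : ∀ x, Integrable (fun z => c * (1 + β * V z)) (P x) :=
    fun x => ((integrable_const _).add ((hVi x).const_mul β)).const_mul c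
  have hw : ∀ x, ∫ z, c * (1 + β * V z) ∂P x ≤ c * (1 + β * (γ * V x + K)) := by
    intro x
    rw [integral_const_mul, integral_add (integrable_const _) ((hVi x).const_mul β),
      integral_const_mul]
    simp only [integral_const, probReal_univ, smul_eq_mul, mul_one]
    gcongr
    exact hdrift x
  have hdiff : ∫ z, φ z ∂P x - ∫ z, φ z ∂P y =
      ∫ z, (φ z - s) ∂P x - ∫ z, (φ z - s) ∂P y := by
    rw [integral_sub (hφi x) (integrable_const _), integral_sub (hφi y) (integrable_const _)]
    simp
  rw [hdiff, mul_comm ρ c, mul_assoc]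
  have hVx := hV0 x
  have hVy := hV0 y
  -- If the sum is at most `R`, both points lie in the sublevel set and the common part `ν` gives
  -- the gain. Otherwise the drift alone suffices, with common part zero.
  by_cases hxy : V x + V y ≤ R
  · have hνw : c * a ≤ ∫ z, c * (1 + β * V z) ∂ν := by
      have h1 : ∫ _z, c ∂ν ≤ ∫ z, c * (1 + β * V z) ∂ν := by
        refine integral_mono (integrable_const _)
          ((hwi x₀).mono_measure hνx₀) fun z => ?_
        have := mul_nonneg hc (mul_nonneg hβ0.le (hV0 z))
        dsimp only
        linarith
      simpa [mul_comm, ha] using h1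
    have key := abs_integral_sub_le_of_common_part (hν x (by linarith)) (hν y (by linarith))
      (hwi x) (hwi y) (hψi x) (hψi y) hs hνw
    refine (key.trans (sub_le_sub_right (add_le_add (hw x) (hw y)) _)).trans ?_
    have h2 : c * (1 + β * (γ * V x + K)) + c * (1 + β * (γ * V y + K)) - 2 * (c * a) =
      c * ((2 - 2 * a + 2 * (β * K)) + γ * (β * (V x + V y))) := by ring
    rw [h2]
    refine mul_le_mul_of_nonneg_left ?_ hc
    have h3 : γ * (β * (V x + V y)) ≤ ρ * (β * (V x + V y)) :=
      mul_le_mul_of_nonneg_right hρ2 (by positivity)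
    linarith
  · push Not at hxy
    have key := abs_integral_sub_le_of_common_part (Measure.zero_le (P x)) (Measure.zero_le (P y))
      (hwi x) (hwi y) (hψi x) (hψi y) hs (a := 0) (by simp)
    refine (key.trans (sub_le_sub_right (add_le_add (hw x) (hw y)) _)).trans ?_
    have h2 : c * (1 + β * (γ * V x + K)) + c * (1 + β * (γ * V y + K)) - 2 * 0 =
      c * (2 + 2 * (β * K) + γ * (β * (V x + V y))) := by ring
    rw [h2]
    refine mul_le_mul_of_nonneg_left ?_ hc
    have h3 : (1 - ε) * (2 + β * (V x + V y)) ≤ ρ * (2 + β * (V x + V y)) :=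
      mul_le_mul_of_nonneg_right hρ1 (by positivity)
    refine le_trans ?_ h3
    set W := V x + V y with hW
    have h4 : ε * (β * W) ≤ (1 - γ) / 4 * (β * W) :=
      mul_le_mul_of_nonneg_right hε1 (by positivity)
    have h5 : β * (1 - γ) * R ≤ β * (1 - γ) * W :=
      mul_le_mul_of_nonneg_left hxy.le (by positivity)
    have h6 : β * (4 * K) ≤ β * (R * (1 - γ)) := mul_le_mul_of_nonneg_left hRK.le hβ0.le
    nlinarith

end Harris

/-! ### Limits in total variation and setwise limits of probability measures. -/

section Limits

variable {α : Type*} [MeasurableSpace α]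

/-- The space of probability measures is complete with respect to total variation. -/
theorem exists_measure_of_uniform_cauchy (μ : ℕ → Measure α) [∀ n, IsProbabilityMeasure (μ n)]
    {δ : ℕ → ℝ} (hδ : Tendsto δ atTop (𝓝 0))
    (h : ∀ n m, n ≤ m → ∀ A, MeasurableSet A → |(μ n).real A - (μ m).real A| ≤ δ n) :
    ∃ μ' : Measure α, IsProbabilityMeasure μ' ∧
      ∀ n A, MeasurableSet A → |(μ n).real A - μ'.real A| ≤ δ n := by
  have hlim : ∀ A, MeasurableSet A → ∃ l, Tendsto (fun n => (μ n).real A) atTop (𝓝 l) := by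
    intro A hA
    refine cauchySeq_tendsto_of_complete (cauchySeq_of_le_tendsto_0' δ (fun n m hnm => ?_) hδ)
    rw [Real.dist_eq]
    exact h n m hnm A hA
  choose l hl using hlim
  have hle : ∀ n A (hA : MeasurableSet A), |(μ n).real A - l A hA| ≤ δ n := fun n A hA =>
    le_of_tendsto ((tendsto_const_nhds.sub (hl A hA)).abs)
      ((eventually_ge_atTop n).mono fun m hm => h n m hm A hA)
  have hl0 : ∀ A (hA : MeasurableSet A), 0 ≤ l A hA := fun A hA =>
    ge_of_tendsto' (hl A hA) fun n => measureReal_nonneg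
  have hempty : l ∅ MeasurableSet.empty = 0 :=
    tendsto_nhds_unique (hl _ _) (by simp)
  have hsum : ∀ ⦃f : ℕ → Set α⦄ (hf : ∀ i, MeasurableSet (f i)),
      Pairwise (Function.onFun Disjoint f) →
      HasSum (fun i => l (f i) (hf i)) (l (⋃ i, f i) (MeasurableSet.iUnion hf)) := by
    intro f hf hd
    rw [hasSum_iff_tendsto_nat_of_nonneg fun i => hl0 _ _]
    have hfin : ∀ k n, ∑ i ∈ Finset.range n, (μ k).real (f i) =
        (μ k).real (⋃ i ∈ Finset.range n, f i) := fun k n =>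
      (measureReal_biUnion_finset (fun i _ j _ hij => hd hij) fun i _ => hf i).symm
    -- The bound is uniform in `n`, because a finite disjoint union is again one measurable set.
    -- This permits the exchange of the limits in `k` and `n`.
    have hpart : ∀ k n, |∑ i ∈ Finset.range n, (μ k).real (f i) -
        ∑ i ∈ Finset.range n, l (f i) (hf i)| ≤ δ k := by
      intro k n
      refine le_of_tendsto ((tendsto_const_nhds.sub
        (tendsto_finsetSum _ fun i _ => hl (f i) (hf i))).abs)
        ((eventually_ge_atTop k).mono fun m hm => ?_)
      rw [hfin, hfin]
      exact h k m hm _ (Finset.measurableSet_biUnion _ fun i _ => hf i)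
    have hμ : ∀ k, Tendsto (fun n => ∑ i ∈ Finset.range n, (μ k).real (f i)) atTop
        (𝓝 ((μ k).real (⋃ i, f i))) := fun k =>
      (by
        simp only [measureReal_def, measure_iUnion hd hf]
        have hne : ∑' i, μ k (f i) ≠ ∞ := by
          rw [← measure_iUnion hd hf]
          exact measure_ne_top _ _
        rw [ENNReal.tsum_toReal_eq fun i => measure_ne_top _ _]
        exact (ENNReal.hasSum_toReal hne).tendsto_sum_nat)
    rw [Metric.tendsto_atTop]
    intro ε hε
    obtain ⟨k, hk⟩ := ((hδ.eventually (gt_mem_nhds (show 0 < ε / 3 by positivity)))).exists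
    obtain ⟨N, hN⟩ := Metric.tendsto_atTop.1 (hμ k) (ε / 3) (by positivity)
    refine ⟨N, fun n hn => ?_⟩
    have h1 := hN n hn
    rw [Real.dist_eq] at h1 ⊢
    have h2 := abs_le.1 (hpart k n)
    have h3 := abs_le.1 (hle k _ (MeasurableSet.iUnion hf))
    have h4 := abs_lt.1 h1
    exact abs_lt.2 ⟨by linarith [h2.2, h3.1], by linarith [h2.1, h3.2]⟩
  let μ' : Measure α := Measure.ofMeasurable (fun A hA => ENNReal.ofReal (l A hA))
    (by simp [hempty]) (fun f hf hd => by
      rw [← (hsum hf hd).tsum_eq, ENNReal.ofReal_tsum_of_nonneg (fun i => hl0 _ _)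
        (hsum hf hd).summable])
  have hμ' : ∀ A (hA : MeasurableSet A), μ'.real A = l A hA := fun A hA => by
    rw [measureReal_def, Measure.ofMeasurable_apply A hA, ENNReal.toReal_ofReal (hl0 _ _)]
  refine ⟨μ', ⟨?_⟩, fun n A hA => hμ' A hA ▸ hle n A hA⟩
  have h1 : l Set.univ MeasurableSet.univ = 1 := tendsto_nhds_unique (hl _ _) (by simp)
  rw [Measure.ofMeasurable_apply _ MeasurableSet.univ, h1, ENNReal.ofReal_one]

/-- By the layer-cake formula the integral of `f` is that of `t ↦ m {t < f}` over `t > 0`. This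
function is at most one and vanishes for `t > 1`, so dominated convergence applies. -/
theorem tendsto_integral_of_tendsto_measureReal {μ : ℕ → Measure α} {μ' : Measure α}
    [∀ n, IsProbabilityMeasure (μ n)] [IsProbabilityMeasure μ']
    (h : ∀ A, MeasurableSet A → Tendsto (fun n => (μ n).real A) atTop (𝓝 (μ'.real A)))
    {f : α → ℝ} (hf : Measurable f) (h0 : ∀ x, 0 ≤ f x) (h1 : ∀ x, f x ≤ 1) :
    Tendsto (fun n => ∫ x, f x ∂μ n) atTop (𝓝 (∫ x, f x ∂μ')) := by
  have hi : ∀ (m : Measure α) [IsProbabilityMeasure m], Integrable f m := fun m _ =>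
    integrable_of_bounded m hf (C := 1) fun x => abs_le.2 ⟨by linarith [h0 x], h1 x⟩
  have e : ∀ (m : Measure α) [IsProbabilityMeasure m],
      ∫ x, f x ∂m = ∫ t in Set.Ioi (0 : ℝ), m.real {a | t < f a} := fun m _ =>
    (hi m).integral_eq_integral_meas_lt (Eventually.of_forall h0)
  simp_rw [fun n => e (μ n), e μ']
  refine tendsto_integral_of_dominated_convergence
    (Set.indicator (Set.Ioc 0 1) fun _ => (1 : ℝ)) (fun n => ?_) ?_ (fun n => ?_) ?_
  · have : Antitone fun t : ℝ => (μ n).real {a | t < f a} := fun s t hst =>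
      measureReal_mono fun a (ha : t < f a) => lt_of_le_of_lt hst ha
    exact this.measurable.aestronglyMeasurable
  · refine IntegrableOn.integrable_indicator ?_ measurableSet_Ioc
    refine integrableOn_const ?_
    exact ((Measure.restrict_apply_le _ _).trans_lt (by simp)).ne
  · refine (ae_restrict_mem measurableSet_Ioi).mono fun t ht => ?_
    by_cases ht1 : t ≤ 1
    · rw [Set.indicator_of_mem (show t ∈ Set.Ioc (0 : ℝ) 1 from ⟨ht, ht1⟩),
        Real.norm_of_nonneg measureReal_nonneg]
      exact measureReal_le_one
    · have : {a | t < f a} = ∅ := by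
        ext a
        simpa using (h1 a).trans (not_le.1 ht1).le
      rw [this, Set.indicator_of_notMem fun h => ht1 h.2]
      simp
  · exact Eventually.of_forall fun t => h _ (measurableSet_lt measurable_const hf)

end Limits

/-! ### Geometric ergodicity, for chains and for semigroups. -/

section Harris

variable {α : Type*} [MeasurableSpace α]

/-- The condition on `K'` is what the induction on the drift inequality requires. The point of the
bound is its uniformity in `n`. -/
theorem lintegral_pow_le (P : Kernel α α) [IsMarkovKernel P] {V : α → ℝ≥0}
    (hV : Measurable V) {γ K K' : ℝ≥0} (hγ : γ ≤ 1)
    (hdrift : ∀ x, ∫⁻ y, V y ∂P x ≤ γ * V x + K) (hK' : γ * K' + K ≤ K') (n : ℕ) (x : α) :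
    ∫⁻ y, V y ∂(P ^ n) x ≤ V x + K' := by
  have := isMarkovKernel_pow P
  induction n with
  | zero =>
    rw [_root_.pow_zero]
    change ∫⁻ y, V y ∂(Kernel.id : Kernel α α) x ≤ _
    rw [Kernel.id_apply, lintegral_dirac' _ (by fun_prop)]
    exact le_self_add
  | succ n ih =>
    rw [_root_.pow_succ']
    change ∫⁻ y, V y ∂(P ∘ₖ (P ^ n)) x ≤ _
    rw [Kernel.lintegral_comp _ _ _ (by fun_prop)]
    calc ∫⁻ y, ∫⁻ z, V z ∂P y ∂(P ^ n) x ≤ ∫⁻ y, (γ * V y + K) ∂(P ^ n) x :=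
          lintegral_mono hdrift
      _ = γ * ∫⁻ y, V y ∂(P ^ n) x + K := by
          rw [lintegral_add_right _ measurable_const, lintegral_const_mul _ (by fun_prop)]
          simp
      _ ≤ γ * (V x + K') + K := by gcongr
      _ = γ * V x + ((γ * K' + K : ℝ≥0) : ℝ≥0∞) := by push_cast; ring
      _ ≤ 1 * V x + K' := by gcongr; exact_mod_cast hγ
      _ = V x + K' := by rw [one_mul]

theorem measurable_integral_kernel (P : Kernel α α) [IsMarkovKernel P] {f : α → ℝ}
    (hf : Measurable f) : Measurable fun x => ∫ y, f y ∂P x :=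
  (hf.stronglyMeasurable.integral_kernel).measurable

theorem abs_integral_le_one (μ : Measure α) [IsProbabilityMeasure μ] {f : α → ℝ}
    (h : ∀ x, |f x| ≤ 1) : |∫ x, f x ∂μ| ≤ 1 := by
  have := norm_integral_le_of_norm_le_const (μ := μ)
    (Eventually.of_forall (p := fun y => ‖f y‖ ≤ 1) h)
  simpa using this

theorem integral_comp_kernel (P Q : Kernel α α) [IsMarkovKernel P] [IsMarkovKernel Q]
    {f : α → ℝ} (hf : Measurable f) (hf1 : ∀ x, |f x| ≤ 1) (x : α) :
    ∫ y, f y ∂(Q ∘ₖ P) x = ∫ y, ∫ z, f z ∂Q y ∂P x :=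
  Kernel.integral_comp (integrable_of_bounded _ hf hf1)

/-- Harris' theorem: geometric ergodicity of a Markov chain that satisfies a drift condition and a
minorization on the sublevel sets of the Lyapunov function. -/
theorem exists_abs_integral_pow_sub_le [Nonempty α] (P : Kernel α α) [IsMarkovKernel P]
    {V : α → ℝ≥0} (hV : Measurable V) {γ K : ℝ≥0} (hγ : γ < 1)
    (hdrift : ∀ x, ∫⁻ y, V y ∂P x ≤ γ * V x + K)
    (hminor : ∀ R : ℝ≥0, ∃ ν : Measure α, ν ≠ 0 ∧ ∀ x, V x ≤ R → ν ≤ P x) :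
    ∃ ρ : ℝ, 0 ≤ ρ ∧ ρ < 1 ∧ ∃ B : α → α → ℝ, (∀ y, Measurable fun x => B x y) ∧
      ∀ f : α → ℝ, Measurable f → (∀ x, |f x| ≤ 1) → ∀ n m x y,
        |∫ z, f z ∂(P ^ n) x - ∫ z, f z ∂(P ^ (n + m)) y| ≤ ρ ^ n * B x y := by
  have hpow := isMarkovKernel_pow P
  -- The fixed point of `t ↦ γ * t + K`.
  set K' : ℝ≥0 := K / (1 - γ) with hK'
  have hγ' : 1 - γ ≠ 0 := (tsub_pos_of_lt hγ).ne'
  have hKK : γ * K' + K ≤ K' := by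
    have h1 : K = (1 - γ) * K' := by rw [hK']; field_simp
    have h2 : γ + (1 - γ) = 1 := add_tsub_cancel_of_le hγ.le
    calc γ * K' + K = (γ + (1 - γ)) * K' := by rw [add_mul, ← h1]
      _ ≤ K' := by rw [h2, one_mul]
  have hmom := lintegral_pow_le P hV hγ.le hdrift hKK
  have hVr : Measurable fun y => (V y : ℝ) := hV.coe_nnreal_real
  have hint : ∀ n x, Integrable (fun y => (V y : ℝ)) ((P ^ n) x) := fun n x => by
    refine ⟨hVr.aestronglyMeasurable, ?_⟩
    rw [hasFiniteIntegral_iff_enorm]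
    simp only [Real.enorm_of_nonneg (NNReal.coe_nonneg _), ENNReal.ofReal_coe_nnreal]
    exact (hmom n x).trans_lt (by exact_mod_cast ENNReal.coe_lt_top (r := V x + K'))
  have htoReal : ∀ (κ : Measure α) (c : ℝ≥0), ∫⁻ y, V y ∂κ ≤ c → ∫ y, (V y : ℝ) ∂κ ≤ c := by
    intro κ c h
    rw [integral_eq_lintegral_of_nonneg_ae (Eventually.of_forall fun y => NNReal.coe_nonneg _)
      hVr.aestronglyMeasurable]
    simp only [ENNReal.ofReal_coe_nnreal]
    exact ENNReal.toReal_le_coe_of_le_coe h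
  obtain ⟨β, hβ, ρ, hρ0, hρ1, hctr⟩ := exists_contraction P (V := fun x => (V x : ℝ))
    (fun x => NNReal.coe_nonneg _) (fun x => by simpa using hint 1 x) (γ := γ) (K := K)
    γ.2 (by exact_mod_cast hγ) K.2
    (fun x => by
      have := htoReal (P x) (γ * V x + K) (by push_cast; exact hdrift x)
      exact_mod_cast this)
    (fun R => by
      obtain ⟨ν, h0, h⟩ := hminor R.toNNReal
      exact ⟨ν, h0, fun x hx => h x (by
        rw [← NNReal.coe_le_coe]; exact hx.trans (Real.le_coe_toNNReal R))⟩)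
  -- The oscillation bound between `x` and `u` is integrated over the law of `u` after `m` steps
  -- from `y`; the moment bound `V y + K'` makes the result independent of `m`.
  refine ⟨ρ, hρ0, hρ1, fun x y => 2 + β * (V x + (V y + K')), fun y => by fun_prop, ?_⟩
  intro f hf hf1 n m x y
  have hstep : ∀ n x, ∫ z, f z ∂(P ^ (n + 1)) x = ∫ u, ∫ z, f z ∂(P ^ n) u ∂P x := fun n x =>
    integral_comp_kernel P (P ^ n) hf hf1 x
  -- The seminorm is at most one for `|f| ≤ 1`, as the oscillation is at most 2, and each step
  -- multiplies it by `ρ`.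
  have hiter : ∀ n x y, |∫ z, f z ∂(P ^ n) x - ∫ z, f z ∂(P ^ n) y| ≤
      ρ ^ n * (2 + β * (V x + V y)) := by
    intro n
    induction n with
    | zero =>
      intro x y
      have h1 := abs_integral_le_one ((P ^ 0) x) hf1
      have h2 := abs_integral_le_one ((P ^ 0) y) hf1
      have h3 : 0 ≤ β * ((V x : ℝ) + V y) := by positivity
      rw [_root_.pow_zero ρ, one_mul]
      exact (abs_sub _ _).trans (by linarith)
    | succ n ih =>
      intro x y
      rw [hstep, hstep, _root_.pow_succ' ρ]
      exact hctr _ (measurable_integral_kernel _ hf) ⟨1, fun x => abs_integral_le_one _ hf1⟩ _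
        (by positivity) ih x y
  have e : ∫ z, f z ∂(P ^ (n + m)) y = ∫ u, ∫ z, f z ∂(P ^ n) u ∂(P ^ m) y := by
    rw [_root_.pow_add]
    exact integral_comp_kernel (P ^ m) (P ^ n) hf hf1 y
  set F : α → ℝ := fun u => ∫ z, f z ∂(P ^ n) u with hF
  have hFi : Integrable F ((P ^ m) y) := integrable_of_bounded _ (measurable_integral_kernel _ hf)
    fun u => abs_integral_le_one _ hf1
  have e2 : F x - ∫ u, F u ∂(P ^ m) y = ∫ u, (F x - F u) ∂(P ^ m) y := by
    rw [integral_sub (integrable_const _) hFi]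
    simp
  rw [e]
  change |F x - ∫ u, F u ∂(P ^ m) y| ≤ _
  rw [e2]
  have hVi : Integrable (fun u => β * ((V x : ℝ) + V u)) ((P ^ m) y) :=
    ((integrable_const _).add (hint m y)).const_mul β
  have hbi : Integrable (fun u => ρ ^ n * (2 + β * ((V x : ℝ) + V u))) ((P ^ m) y) :=
    ((integrable_const _).add hVi).const_mul _
  calc |∫ u, (F x - F u) ∂(P ^ m) y| ≤ ∫ u, |F x - F u| ∂(P ^ m) y := abs_integral_le_integral_abs
    _ ≤ ∫ u, ρ ^ n * (2 + β * ((V x : ℝ) + V u)) ∂(P ^ m) y :=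
        integral_mono ((integrable_const _).sub hFi).abs hbi fun u => hiter n x u
    _ = ρ ^ n * (2 + β * (V x + ∫ u, (V u : ℝ) ∂(P ^ m) y)) := by
        rw [integral_const_mul, integral_add (integrable_const _) hVi, integral_const_mul,
          integral_add (integrable_const _) (hint m y)]
        simp
    _ ≤ _ := by
        have := htoReal _ (V y + K') (by push_cast; exact hmom m y)
        push_cast at this
        dsimp only
        gcongr

/-- Both orders of composition are used: that the kernels commute gives the invariance of the limit
at non-integer times. -/
theorem semigroup_add_nat {P : ℝ≥0 → Kernel α α} (hadd : ∀ s t, P (s + t) = P t ∘ₖ P s)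
    (n : ℕ) (s : ℝ≥0) : P (n + s) = P s ∘ₖ (P 1 ^ n) ∧ P (n + s) = (P 1 ^ n) ∘ₖ P s := by
  induction n with
  | zero =>
    simp only [Nat.cast_zero, zero_add, _root_.pow_zero]
    exact ⟨(Kernel.comp_id _).symm, (Kernel.id_comp _).symm⟩
  | succ n ih =>
    constructor
    · rw [show ((n + 1 : ℕ) : ℝ≥0) + s = 1 + (n + s) by push_cast; ring, hadd, ih.1,
        Kernel.comp_assoc, _root_.pow_succ]
      rfl
    · rw [show ((n + 1 : ℕ) : ℝ≥0) + s = (n + s) + 1 by push_cast; ring, hadd, ih.2,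
        ← Kernel.comp_assoc, _root_.pow_succ']
      rfl

theorem integral_kernel_eq_bind (μ : Measure α) [IsProbabilityMeasure μ] (Q : Kernel α α)
    [IsMarkovKernel Q] {A : Set α} (hA : MeasurableSet A) :
    ∫ x, (Q x).real A ∂μ = (μ.bind Q).real A := by
  simp only [measureReal_def]
  rw [integral_toReal (Kernel.measurable_coe Q hA).aemeasurable
    (Eventually.of_forall fun x => measure_lt_top _ _), Measure.bind_apply hA Q.aemeasurable]

theorem ext_of_measureReal_eq {μ ν : Measure α} [IsFiniteMeasure μ] [IsFiniteMeasure ν]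
    (h : ∀ A, MeasurableSet A → μ.real A = ν.real A) : μ = ν :=
  Measure.ext fun A hA => (measureReal_eq_measureReal_iff).1 (h A hA)

/-- Harris' theorem for a semigroup of Markov kernels. -/
theorem exists_unique_invariant_of_drift [Nonempty α] (P : ℝ≥0 → Kernel α α)
    [hP : ∀ t, IsMarkovKernel (P t)] (hadd : ∀ s t, P (s + t) = P t ∘ₖ P s)
    {V : α → ℝ≥0} (hV : Measurable V) {γ K : ℝ≥0} (hγ : γ < 1)
    (hdrift : ∀ x, ∫⁻ y, V y ∂P 1 x ≤ γ * V x + K)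
    (hminor : ∀ R : ℝ≥0, ∃ ν : Measure α, ν ≠ 0 ∧ ∀ x, V x ≤ R → ν ≤ P 1 x) :
    ∃ μ : Measure α, IsProbabilityMeasure μ ∧ (∀ t, (P t).Invariant μ) ∧
      (∀ μ' : Measure α, IsProbabilityMeasure μ' → (∀ t, (P t).Invariant μ') → μ' = μ) ∧
      ∀ ν : Measure α, IsProbabilityMeasure ν →
        TendstoInTotalVariation (fun t => ν.bind (P t)) μ := by
  have hpow := isMarkovKernel_pow (P 1)
  obtain ⟨ρ, hρ0, hρ1, B, hB, hρ⟩ := exists_abs_integral_pow_sub_le (P 1) hV hγ hdrift hminor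
  obtain ⟨x₀⟩ := ‹Nonempty α›
  have hρn := tendsto_pow_atTop_nhds_zero_of_lt_one hρ0 hρ1
  have hreal : ∀ (m : Measure α) A, MeasurableSet A →
      ∫ z, Set.indicator A (fun _ => (1 : ℝ)) z ∂m = m.real A := fun m A hA => by
    rw [integral_indicator hA]; simp
  have hset : ∀ A, MeasurableSet A → ∀ n m x y,
      |((P 1 ^ n) x).real A - ((P 1 ^ (n + m)) y).real A| ≤ ρ ^ n * B x y := by
    intro A hA n m x y
    have := hρ (Set.indicator A fun _ => (1 : ℝ)) (measurable_const.indicator hA)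
      (fun x => by by_cases h : x ∈ A <;> simp [h]) n m x y
    rwa [hreal _ _ hA, hreal _ _ hA] at this
  obtain ⟨μ, hμ, hμlim⟩ := exists_measure_of_uniform_cauchy (fun n => (P 1 ^ n) x₀)
    (δ := fun n => ρ ^ n * B x₀ x₀) (by simpa using hρn.mul_const (B x₀ x₀))
    (fun n m hnm A hA => by
      obtain ⟨k, rfl⟩ := Nat.exists_eq_add_of_le hnm
      exact hset A hA n k x₀ x₀)
  have hsetlim : ∀ A, MeasurableSet A →
      Tendsto (fun n => ((P 1 ^ n) x₀).real A) atTop (𝓝 (μ.real A)) := by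
    intro A hA
    rw [tendsto_iff_dist_tendsto_zero]
    refine squeeze_zero (fun n => dist_nonneg) (fun n => ?_)
      (by simpa using hρn.mul_const (B x₀ x₀))
    rw [Real.dist_eq]
    exact hμlim n A hA
  -- The estimate between `x` at time `n` and `x₀` at time `n + m`, in the limit `m → ∞`.
  have hfun : ∀ f : α → ℝ, Measurable f → (∀ x, 0 ≤ f x) → (∀ x, f x ≤ 1) → ∀ n x,
      |∫ z, f z ∂(P 1 ^ n) x - ∫ z, f z ∂μ| ≤ ρ ^ n * B x x₀ := by
    intro f hf h0 h1 n x
    have hl := tendsto_integral_of_tendsto_measureReal hsetlim hf h0 h1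
    have hl' := hl.comp (tendsto_add_atTop_nat n)
    refine le_of_tendsto ((tendsto_const_nhds.sub hl').abs) (Eventually.of_forall fun m => ?_)
    have := hρ f hf (fun x => abs_le.2 ⟨by linarith [h0 x], h1 x⟩) n m x x₀
    rwa [add_comm n m] at this
  have hker : ∀ t A, MeasurableSet A → Measurable fun x => (P t x).real A := fun t A hA =>
    (Kernel.measurable_coe (P t) hA).ennreal_toReal
  -- The mass of `A` after the time `n + t` from `x₀` has two limits as `n → ∞`. With the time `t`
  -- last, it tends to the mass of `A` under `μ.bind (P t)`; with the time `t` first, it tends to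
  -- `μ.real A` by dominated convergence.
  have hinv : ∀ t, (P t).Invariant μ := by
    intro t
    have : IsProbabilityMeasure (μ.bind (P t)) := inferInstance
    refine ext_of_measureReal_eq fun A hA => ?_
    rw [← integral_kernel_eq_bind _ _ hA]
    have l1 := tendsto_integral_of_tendsto_measureReal hsetlim (hker t A hA)
      (fun x => measureReal_nonneg) (fun x => measureReal_le_one)
    have e : ∀ n, ∫ x, (P t x).real A ∂(P 1 ^ n) x₀ =
        ∫ y, ((P 1 ^ n) y).real A ∂P t x₀ := by
      intro n
      rw [integral_kernel_eq_bind _ _ hA, integral_kernel_eq_bind _ _ hA,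
        ← Kernel.comp_apply, ← Kernel.comp_apply, ← (semigroup_add_nat hadd n t).1,
        ← (semigroup_add_nat hadd n t).2]
    simp_rw [e] at l1
    have l2 : Tendsto (fun n => ∫ y, ((P 1 ^ n) y).real A ∂P t x₀) atTop
        (𝓝 (∫ y, μ.real A ∂P t x₀)) := by
      refine tendsto_integral_of_dominated_convergence (fun _ => 1) (fun n => ?_)
        (integrable_const _) (fun n => Eventually.of_forall fun y => ?_)
        (Eventually.of_forall fun y => ?_)
      · exact (Kernel.measurable_coe (P 1 ^ n) hA).ennreal_toReal.aestronglyMeasurable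
      · rw [Real.norm_of_nonneg measureReal_nonneg]
        exact measureReal_le_one
      · rw [tendsto_iff_dist_tendsto_zero]
        refine squeeze_zero (fun n => dist_nonneg) (fun n => ?_)
          (by simpa using hρn.mul_const (B y x₀))
        rw [Real.dist_eq]
        have := hfun (Set.indicator A fun _ => (1 : ℝ)) (measurable_const.indicator hA)
          (fun x => by by_cases h : x ∈ A <;> simp [h])
          (fun x => by by_cases h : x ∈ A <;> simp [h]) n y
        rwa [hreal _ _ hA, hreal _ _ hA] at this
    simpa using tendsto_nhds_unique l1 l2
  have hconv : ∀ ν : Measure α, IsProbabilityMeasure ν →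
      TendstoInTotalVariation (fun t => ν.bind (P t)) μ := by
    intro ν hν ε hε
    -- The test function `u ↦ (P s u).real A` in `hfun` gives a bound uniform in `s` and `A`. The
    -- minimum with one is taken because `B` need not be integrable for the initial law `ν`.
    have hpt : ∀ (n : ℕ) (s : ℝ≥0) x A, MeasurableSet A →
        |(P (n + s) x).real A - μ.real A| ≤ min 1 |ρ ^ n * B x x₀| := by
      intro n s x A hA
      refine le_min ?_ ?_
      · have h1 : (P (n + s) x).real A ≤ 1 := measureReal_le_one
        have h2 : μ.real A ≤ 1 := measureReal_le_one
        have h3 : 0 ≤ (P (n + s) x).real A := measureReal_nonneg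
        have h4 : 0 ≤ μ.real A := measureReal_nonneg
        exact abs_le.2 ⟨by linarith, by linarith⟩
      · have h1 := hfun _ (hker s A hA) (fun x => measureReal_nonneg)
          (fun x => measureReal_le_one) n x
        rw [integral_kernel_eq_bind _ _ hA, integral_kernel_eq_bind _ _ hA,
          (show μ.bind (P s) = μ from hinv s),
          ← Kernel.comp_apply, ← (semigroup_add_nat hadd n s).1] at h1
        exact h1.trans (le_abs_self _)
    have hmeas : ∀ n : ℕ, Measurable fun x => min 1 |ρ ^ n * B x x₀| := fun n =>
      measurable_const.min ((hB x₀).const_mul _).abs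
    have hle1 : ∀ (n : ℕ) x, |(min 1 |ρ ^ n * B x x₀| : ℝ)| ≤ 1 := fun n x => by
      rw [abs_of_nonneg (le_min zero_le_one (abs_nonneg _))]
      exact min_le_left _ _
    have hlim : Tendsto (fun n : ℕ => ∫ x, min 1 |ρ ^ n * B x x₀| ∂ν) atTop (𝓝 (∫ _, 0 ∂ν)) := by
      refine tendsto_integral_of_dominated_convergence (fun _ => 1)
        (fun n => (hmeas n).aestronglyMeasurable) (integrable_const _)
        (fun n => Eventually.of_forall fun x => hle1 n x) (Eventually.of_forall fun x => ?_)
      have h1 : Tendsto (fun n : ℕ => |ρ ^ n * B x x₀|) atTop (𝓝 0) := by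
        simpa using (hρn.mul_const (B x x₀)).abs
      simpa using (tendsto_const_nhds (x := (1 : ℝ))).min h1
    rw [integral_zero] at hlim
    obtain ⟨N, hN⟩ := (hlim.eventually (gt_mem_nhds hε)).exists
    refine ⟨N, fun t ht A hA => ?_⟩
    obtain ⟨s, rfl⟩ := exists_add_of_le ht
    have hi : Integrable (fun x => (P (N + s) x).real A) ν :=
      integrable_of_bounded _ (hker _ A hA) (C := 1) fun x => by
        rw [abs_of_nonneg measureReal_nonneg]; exact measureReal_le_one
    have e : (ν.bind (P (N + s))).real A - μ.real A =
        ∫ x, ((P (N + s) x).real A - μ.real A) ∂ν := by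
      rw [← integral_kernel_eq_bind _ _ hA, integral_sub hi (integrable_const _)]
      simp
    dsimp only
    rw [e]
    refine abs_integral_le_integral_abs.trans (le_trans ?_ hN.le)
    exact integral_mono (hi.sub (integrable_const _)).abs
      (integrable_of_bounded _ (hmeas N) (hle1 N)) fun x => hpt N s x A hA
  refine ⟨μ, hμ, hinv, fun μ' hμ' hinv' => ?_, hconv⟩
  refine ext_of_measureReal_eq fun A hA => ?_
  -- An invariant measure is its own law at all times, so convergence from it identifies it with
  -- `μ`.
  refine eq_of_abs_sub_eq_zero (le_antisymm (le_of_forall_pos_le_add fun ε hε => ?_) (abs_nonneg _))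
  obtain ⟨t, ht⟩ := hconv μ' hμ' ε hε
  have := ht t le_rfl A hA
  simp only [show μ'.bind (P t) = μ' from hinv' t] at this
  linarith

end Harris

/-! ### The effect of a ring on the energies -/

section Energies

variable {d : ℕ} {S : Set (Fin d → ℤ)} {M : ℕ}

/-- The energies of the sites and of the particles. -/
def energy (x : State S M) : S ⊕ Fin M → ℝ≥0 := Sum.elim x.1 x.2.1

theorem measurable_energy (i : S ⊕ Fin M) : Measurable fun x : State S M => energy x i := by
  rcases i with v | k
  · change Measurable fun x : State S M => x.1 v
    fun_prop
  · change Measurable fun x : State S M => x.2.1 k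
    fun_prop

theorem pooled_eq (x : State S M) (k : Fin M) :
    pooled x k = energy x (Sum.inl (x.2.2 k)) + energy x (Sum.inr k) := rfl

theorem State.ext_energy {x y : State S M} (hX : x.2.2 = y.2.2) (h : energy x = energy y) :
    x = y := by
  refine Prod.ext ?_ (Prod.ext ?_ hX)
  · exact funext fun v => congrFun h (Sum.inl v)
  · exact funext fun k => congrFun h (Sum.inr k)

theorem energy_jumpInside (x : State S M) (k : Fin M) (w : S) (p : ℝ) (i : S ⊕ Fin M) :
    energy (jumpInside x k w p) i = if i = Sum.inl (x.2.2 k) then p.toNNReal * pooled x k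
      else if i = Sum.inr k then (1 - p).toNNReal * pooled x k else energy x i := by
  rcases i with v | j
  · by_cases h : v = x.2.2 k <;> simp [energy, jumpInside, h]
  · by_cases h : j = k <;> simp [energy, jumpInside, h]

theorem energy_jumpBath (x : State S M) (k : Fin M) (p e : ℝ) (i : S ⊕ Fin M) :
    energy (jumpBath x k p e) i = if i = Sum.inl (x.2.2 k) then p.toNNReal * pooled x k
      else if i = Sum.inr k then e.toNNReal else energy x i := by
  rcases i with v | j
  · by_cases h : v = x.2.2 k <;> simp [energy, jumpBath, h]
  · by_cases h : j = k <;> simp [energy, jumpBath, h]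

/-- The positions decide which coordinates are updated; there are only countably many configurations
of them, so each may be fixed. -/
theorem measurable_jumpInside_uncurry (k : Fin M) (w : S) :
    Measurable fun q : State S M × ℝ => jumpInside q.1 k w q.2 := by
  have key : Measurable fun q : (((S → ℝ≥0) × (Fin M → ℝ≥0)) × ℝ) × (Fin M → S) =>
      jumpInside (q.1.1.1, q.1.1.2, q.2) k w q.1.2 :=
    measurable_from_prod_countable_left fun X => measurable_jumpInside k w X
  exact key.comp (show Measurable fun q : State S M × ℝ =>
    (((q.1.1, q.1.2.1), q.2), q.1.2.2) by fun_prop)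

theorem measurable_jumpBath_uncurry (k : Fin M) :
    Measurable fun q : State S M × ℝ × ℝ => jumpBath q.1 k q.2.1 q.2.2 := by
  have key : Measurable fun q : (((S → ℝ≥0) × (Fin M → ℝ≥0)) × ℝ × ℝ) × (Fin M → S) =>
      jumpBath (q.1.1.1, q.1.1.2, q.2) k q.1.2.1 q.1.2.2 :=
    measurable_from_prod_countable_left fun X => measurable_jumpBath k X
  exact key.comp (show Measurable fun q : State S M × ℝ × ℝ =>
    (((q.1.1, q.1.2.1), q.2), q.1.2.2) by fun_prop)

/-- The states in which the particles have the positions `X`, the coordinates in `C` have at least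
the energy `r⁻¹`, and no coordinate has more than the energy `r`. -/
def box (X : Fin M → S) (C : Set (S ⊕ Fin M)) (r : ℝ≥0) : Set (State S M) :=
  {x | x.2.2 = X ∧ (∀ i ∈ C, r⁻¹ ≤ energy x i) ∧ ∀ i, energy x i ≤ r}

theorem measurableSet_box [Finite S] (X : Fin M → S) (C : Set (S ⊕ Fin M)) (r : ℝ≥0) :
    MeasurableSet (box X C r) := by
  have h1 : MeasurableSet {x : State S M | x.2.2 = X} :=
    (measurable_snd.comp measurable_snd) (measurableSet_singleton X)
  have h2 : MeasurableSet {x : State S M | ∀ i, i ∈ C → r⁻¹ ≤ energy x i} := by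
    simp only [Set.ofPred_forall]
    exact MeasurableSet.iInter fun i => MeasurableSet.iInter fun _ =>
      measurableSet_le measurable_const (measurable_energy i)
  have h3 : MeasurableSet {x : State S M | ∀ i, energy x i ≤ r} := by
    simp only [Set.ofPred_forall]
    exact MeasurableSet.iInter fun i => measurableSet_le (measurable_energy i) measurable_const
  exact h1.inter (h2.inter h3)

theorem box_mono {X : Fin M → S} {C C' : Set (S ⊕ Fin M)} {r r' : ℝ≥0} (hC : C' ⊆ C)
    (hr : 0 < r) (hrr : r ≤ r') : box X C r ⊆ box X C' r' := by
  rintro x ⟨h1, h2, h3⟩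
  exact ⟨h1, fun i hi => (inv_anti₀ hr hrr).trans (h2 i (hC hi)), fun i => (h3 i).trans hrr⟩

/-- Restricting the fraction to the middle third costs only a factor in the probability and leaves
both partners with at least a third of the pooled energy. -/
theorem third_le {p : ℝ} (hp : p ∈ Set.Icc (1 / 3 : ℝ) (2 / 3)) :
    3⁻¹ ≤ p.toNNReal ∧ p.toNNReal ≤ 1 ∧ 3⁻¹ ≤ (1 - p).toNNReal ∧ (1 - p).toNNReal ≤ 1 := by
  obtain ⟨h1, h2⟩ := hp
  refine ⟨?_, ?_, ?_, ?_⟩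
  · rw [Real.le_toNNReal_iff_coe_le (by linarith)]; push_cast; linarith
  · rw [Real.toNNReal_le_one]; linarith
  · rw [Real.le_toNNReal_iff_coe_le (by linarith)]; push_cast; linarith
  · rw [Real.toNNReal_le_one]; linarith

theorem pooled_le {X : Fin M → S} {C : Set (S ⊕ Fin M)} {r : ℝ≥0} {x : State S M}
    (hx : x ∈ box X C r) (k : Fin M) : pooled x k ≤ 2 * r := by
  rw [pooled_eq, two_mul]
  exact add_le_add (hx.2.2 _) (hx.2.2 _)

theorem mul_pooled_le {X : Fin M → S} {C : Set (S ⊕ Fin M)} {r q : ℝ≥0} {x : State S M}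
    (hx : x ∈ box X C r) (k : Fin M) (hq : q ≤ 1) : q * pooled x k ≤ 3 * r :=
  calc q * pooled x k ≤ 1 * (2 * r) := mul_le_mul' hq (pooled_le hx k)
    _ ≤ 3 * r := by rw [one_mul]; gcongr; norm_num

theorem le_mul_pooled {X : Fin M → S} {C : Set (S ⊕ Fin M)} {r q : ℝ≥0} {x : State S M}
    (hx : x ∈ box X C r) (k : Fin M) (hq : 3⁻¹ ≤ q)
    (hC : Sum.inl (X k) ∈ C ∨ Sum.inr k ∈ C) : (3 * r)⁻¹ ≤ q * pooled x k := by
  rw [mul_inv]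
  refine mul_le_mul' hq ?_
  rw [pooled_eq, hx.1]
  rcases hC with h | h
  · exact (hx.2.1 _ h).trans le_self_add
  · exact (hx.2.1 _ h).trans le_add_self

/-- An energized coordinate stays energized, and the site that is left becomes energized if the
particle was. The factor 3 covers the smallest share, one third, and the largest pooled energy, `2 *
r`. -/
theorem jumpInside_mem_box {X : Fin M → S} {C C' : Set (S ⊕ Fin M)} {r : ℝ≥0} {k : Fin M}
    (hr : 1 ≤ r) (hC : ∀ i ∈ C', i ∈ C ∨ i = Sum.inl (X k) ∧ Sum.inr k ∈ C) {x : State S M}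
    (hx : x ∈ box X C r) (w : S) {p : ℝ} (hp : p ∈ Set.Icc (1 / 3 : ℝ) (2 / 3)) :
    jumpInside x k w p ∈ box (Function.update X k w) C' (3 * r) := by
  obtain ⟨hp1, hp2, hp3, hp4⟩ := third_le hp
  have hr3 : r ≤ 3 * r := le_mul_of_one_le_left' (by norm_num)
  refine ⟨by rw [← hx.1]; rfl, fun i hi => ?_, fun i => ?_⟩
  · rw [energy_jumpInside, hx.1]
    split_ifs with h1 h2
    · refine le_mul_pooled hx k hp1 ?_
      rcases hC i hi with h | h
      · exact Or.inl (h1 ▸ h)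
      · exact Or.inr h.2
    · refine le_mul_pooled hx k hp3 (Or.inr ?_)
      rcases hC i hi with h | h
      · exact h2 ▸ h
      · exact h.2
    · rcases hC i hi with h | h
      · exact (inv_anti₀ (by positivity) hr3).trans (hx.2.1 i h)
      · exact absurd h.1 h1
  · rw [energy_jumpInside]
    split_ifs
    · exact mul_pooled_le hx k hp2
    · exact mul_pooled_le hx k hp4
    · exact (hx.2.2 i).trans hr3

/-- The bath energizes the particle whatever it had before; `1 ≤ r` ensures that `[1, 2]` lies
within the bounds of the new box. -/
theorem jumpBath_mem_box {X : Fin M → S} {C C' : Set (S ⊕ Fin M)} {r : ℝ≥0} {k : Fin M}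
    (hr : 1 ≤ r)
    (hC : ∀ i ∈ C', i ∈ C ∨ i = Sum.inr k ∨ i = Sum.inl (X k) ∧ Sum.inr k ∈ C) {x : State S M}
    (hx : x ∈ box X C r) {p e : ℝ} (hp : p ∈ Set.Icc (1 / 3 : ℝ) (2 / 3))
    (he : e ∈ Set.Icc (1 : ℝ) 2) : jumpBath x k p e ∈ box X C' (3 * r) := by
  obtain ⟨hp1, hp2, -, -⟩ := third_le hp
  have hr3 : r ≤ 3 * r := le_mul_of_one_le_left' (by norm_num)
  have h31 : 1 ≤ 3 * r := hr.trans hr3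
  refine ⟨hx.1, fun i hi => ?_, fun i => ?_⟩
  · rw [energy_jumpBath, hx.1]
    split_ifs with h1 h2
    · refine le_mul_pooled hx k hp1 ?_
      rcases hC i hi with h | h | h
      · exact Or.inl (h1 ▸ h)
      · simp [h1] at h
      · exact Or.inr h.2
    · refine (inv_le_one_of_one_le₀ h31).trans ?_
      rw [Real.one_le_toNNReal]
      exact he.1
    · rcases hC i hi with h | h | h
      · exact (inv_anti₀ (by positivity) hr3).trans (hx.2.1 i h)
      · exact absurd h h2
      · exact absurd h.1 h1
  · rw [energy_jumpBath]
    split_ifs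
    · exact mul_pooled_le hx k hp2
    · have h2 : e.toNNReal ≤ 2 := by
        rw [Real.toNNReal_le_iff_le_coe]; exact_mod_cast he.2
      calc e.toNNReal ≤ 3 * 1 := h2.trans (by norm_num)
        _ ≤ 3 * r := by gcongr
    · exact (hx.2.2 i).trans hr3

end Energies

/-! ### Lower bounds for the transition kernel -/

section LowerBounds

variable {d : ℕ} {S : Set (Fin d → ℤ)} {τ : (Fin d → ℤ) → ℝ} {M : ℕ}

/-- The probability with which a given particle and a given direction are chosen at a ring. -/
def choiceProb (d M : ℕ) : ℝ≥0∞ := ((2 * d * M : ℕ) : ℝ≥0∞)⁻¹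

theorem choiceProb_ne_zero (d M : ℕ) : choiceProb d M ≠ 0 :=
  ENNReal.inv_ne_zero.2 (ENNReal.natCast_ne_top _)

theorem choiceProb_ne_top {d M : ℕ} (hd : 0 < d) (hM : 0 < M) : choiceProb d M ≠ ∞ :=
  ENNReal.inv_ne_top.2 (by simp; omega)

theorem ringKernel_apply (x : State S M) :
    ringKernel S τ M x = ∑ k, ∑ a, choiceProb d M • ringLaw S τ k a x := rfl

theorem measure_le_finsetSum {α ι : Type*} [MeasurableSpace α] {s : Finset ι} {i : ι}
    (hi : i ∈ s) (μ : ι → Measure α) : μ i ≤ ∑ j ∈ s, μ j := by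
  refine Measure.le_iff.2 fun A hA => ?_
  rw [Measure.finsetSum_apply]
  exact Finset.single_le_sum (f := fun j => μ j A) (fun _ _ => zero_le) hi

theorem smul_ringLaw_le (k : Fin M) (a : Fin d × Bool) (x : State S M) :
    choiceProb d M • ringLaw S τ k a x ≤ ringKernel S τ M x := by
  rw [ringKernel_apply]
  exact (measure_le_finsetSum (Finset.mem_univ a)
      fun a => choiceProb d M • ringLaw S τ k a x).trans
    (measure_le_finsetSum (Finset.mem_univ k) fun k => ∑ a, choiceProb d M • ringLaw S τ k a x)

theorem measurable_jumpInside_right (x : State S M) (k : Fin M) (w : S) :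
    Measurable (jumpInside x k w) :=
  (measurable_jumpInside_uncurry k w).comp measurable_prodMk_left

theorem measurable_jumpBath_right (x : State S M) (k : Fin M) :
    Measurable fun q : ℝ × ℝ => jumpBath x k q.1 q.2 :=
  (measurable_jumpBath_uncurry k).comp measurable_prodMk_left

theorem smul_map_jumpInside_le {x : State S M} {k : Fin M} {w : S}
    (h : (latticeGraph d).Adj (x.2.2 k) w) :
    choiceProb d M • (volume.restrict (Set.Icc (0 : ℝ) 1)).map (jumpInside x k w) ≤
      ringKernel S τ M x := by
  obtain ⟨a, ha⟩ := h
  have hw : target x k a = w := ha.symm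
  have hmem : target x k a ∈ S := hw ▸ w.2
  have e : ringLaw S τ k a x =
      (volume.restrict (Set.Icc (0 : ℝ) 1)).map (jumpInside x k w) := by
    rw [ringLaw, dif_pos hmem]
    congr 2
    exact Subtype.ext hw
  exact e ▸ smul_ringLaw_le k a x

/-- The exponential density is decreasing, hence at least its value at 2 on this interval. -/
theorem smul_restrict_le_expMeasure {β : ℝ} (hβ : 0 < β) :
    ENNReal.ofReal (β * Real.exp (-(β * 2))) • volume.restrict (Set.Icc (1 : ℝ) 2) ≤
      expMeasure β := by
  change _ ≤ volume.withDensity (exponentialPDF β)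
  rw [← withDensity_const,
    ← withDensity_indicator measurableSet_Icc]
  refine withDensity_mono (Eventually.of_forall fun e => ?_)
  by_cases he : e ∈ Set.Icc (1 : ℝ) 2
  · rw [Set.indicator_of_mem he, exponentialPDF_of_nonneg (by linarith [he.1])]
    refine ENNReal.ofReal_le_ofReal ?_
    have := he.2
    gcongr
  · rw [Set.indicator_of_notMem he]
    exact zero_le

/-- The temperature is absorbed into the constant `c`, which depends on the site and the direction
only; the energy from the bath may then be taken uniform on `[1, 2]`. -/
theorem exists_smul_map_jumpBath_le (hτ : ∀ w ∈ bath S, 0 < τ w) {v : S} {a : Fin d × Bool}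
    (hv : (v : Fin d → ℤ) + unitStep a ∈ bath S) :
    ∃ c : ℝ≥0∞, c ≠ 0 ∧ c ≠ ∞ ∧ ∀ (k : Fin M) (x : State S M), x.2.2 k = v →
      (c * choiceProb d M) • ((volume.restrict (Set.Icc (0 : ℝ) 1)).prod
        (volume.restrict (Set.Icc (1 : ℝ) 2))).map (fun q => jumpBath x k q.1 q.2) ≤
          ringKernel S τ M x := by
  have hβ := inv_pos.2 (hτ _ hv)
  set β := (τ ((v : Fin d → ℤ) + unitStep a))⁻¹ with hβe
  have := isProbabilityMeasure_expMeasure hβ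
  set c := ENNReal.ofReal (β * Real.exp (-(β * 2)))
  refine ⟨c, ?_, ENNReal.ofReal_ne_top, fun k x hx => ?_⟩
  · rw [ne_eq, ENNReal.ofReal_eq_zero, not_le]
    positivity
  have ht : target x k a = (v : Fin d → ℤ) + unitStep a := by rw [target, hx]
  have e : ringLaw S τ k a x = ((volume.restrict (Set.Icc (0 : ℝ) 1)).prod
      (expMeasure β)).map fun q => jumpBath x k q.1 q.2 := by
    rw [ringLaw, dif_neg (by rw [ht]; exact hv.2), if_pos (by rw [ht]; exact hv), ht]
  refine le_trans ?_ (smul_ringLaw_le k a x)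
  rw [e, mul_comm, mul_smul]
  refine Measure.le_iff.2 fun A hA => ?_
  simp only [Measure.smul_apply, smul_eq_mul]
  gcongr 1
  rw [← smul_eq_mul, ← Measure.smul_apply, ← Measure.map_smul, ← Measure.prod_smul_right]
  have hle : (volume.restrict (Set.Icc (0 : ℝ) 1)).prod
      (c • volume.restrict (Set.Icc (1 : ℝ) 2)) ≤
      (volume.restrict (Set.Icc (0 : ℝ) 1)).prod (expMeasure β) :=
    Measure.prod_mono le_rfl (smul_restrict_le_expMeasure hβ)
  exact Measure.map_mono hle (measurable_jumpBath_right x k) A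

end LowerBounds

/-! ### Accessibility and minorization -/

section Accessibility

variable {d : ℕ} {S : Set (Fin d → ℤ)} {M : ℕ}

/-- From the states in a box with the positions `X` in which the coordinates in `C` have positive
energy, the chain gets with a positive probability, bounded below, to a box with the positions
`X'` in which the coordinates in `C'` have positive energy. -/
def Reach (τ : (Fin d → ℤ) → ℝ) (X : Fin M → S) (C : Set (S ⊕ Fin M)) (X' : Fin M → S)
    (C' : Set (S ⊕ Fin M)) : Prop :=
  ∀ r : ℝ≥0, 1 ≤ r → ∃ r' : ℝ≥0, 1 ≤ r' ∧ ∃ n : ℕ, ∃ c : ℝ≥0∞, c ≠ 0 ∧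
    ∀ x ∈ box X C r, c ≤ (ringKernel S τ M ^ n) x (box X' C' r')

/-- From a box with the positions `X` in which all coordinates have positive energy, the law of the
chain at some time is bounded below by a nonzero measure that depends on the initial state only
through the energies of the coordinates outside `A`. -/
def Minorized (τ : (Fin d → ℤ) → ℝ) (X : Fin M → S) (A : Set (S ⊕ Fin M)) : Prop :=
  ∀ r : ℝ≥0, 1 ≤ r → ∃ n : ℕ, ∃ Γ : Kernel (State S M) (State S M),
    (∀ x ∈ box X Set.univ r, Γ x ≠ 0) ∧
    (∀ x ∈ box X Set.univ r, ∀ y ∈ box X Set.univ r,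
      (∀ i, i ∉ A → energy x i = energy y i) → Γ x = Γ y) ∧
    ∀ x ∈ box X Set.univ r, Γ x ≤ (ringKernel S τ M ^ n) x

variable {τ : (Fin d → ℤ) → ℝ}

/-- The Chapman–Kolmogorov equation combined with Markov's inequality. -/
theorem mul_le_pow_add {α : Type*} [MeasurableSpace α] (κ : Kernel α α) {m n : ℕ} {x : α}
    {B C : Set α} {b c : ℝ≥0∞} (hC : MeasurableSet C) (hb : b ≤ (κ ^ m) x B)
    (hc : ∀ y ∈ B, c ≤ (κ ^ n) y C) : c * b ≤ (κ ^ (m + n)) x C := by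
  rw [Kernel.pow_add_apply_eq_lintegral _ _ _ _ hC]
  calc c * b ≤ c * (κ ^ m) x {y | c ≤ (κ ^ n) y C} := by
        gcongr
        exact hb.trans (measure_mono hc)
    _ ≤ _ := mul_meas_ge_le_lintegral (Kernel.measurable_coe _ hC) c

theorem Reach.refl [Finite S] (X : Fin M → S) (C : Set (S ⊕ Fin M)) : Reach τ X C X C := by
  intro r hr
  refine ⟨r, hr, 0, 1, one_ne_zero, fun x hx => ?_⟩
  change 1 ≤ (Kernel.id : Kernel (State S M) (State S M)) x _
  rw [Kernel.id_apply, Measure.dirac_apply' _ (measurableSet_box _ _ _)]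
  simp [hx]

theorem Reach.trans [Finite S] {X₁ X₂ X₃ : Fin M → S} {C₁ C₂ C₃ : Set (S ⊕ Fin M)}
    (h₁ : Reach τ X₁ C₁ X₂ C₂) (h₂ : Reach τ X₂ C₂ X₃ C₃) : Reach τ X₁ C₁ X₃ C₃ := by
  intro r hr
  obtain ⟨r₁, hr₁, m, b, hb, h⟩ := h₁ r hr
  obtain ⟨r₂, hr₂, n, c, hc, h'⟩ := h₂ r₁ hr₁
  exact ⟨r₂, hr₂, m + n, c * b, mul_ne_zero hc hb, fun x hx =>
    mul_le_pow_add _ (measurableSet_box _ _ _) (h x hx) h'⟩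

theorem Reach.mono {X X' : Fin M → S} {C C' C'' : Set (S ⊕ Fin M)}
    (h : Reach τ X C X' C') (hC : C'' ⊆ C') : Reach τ X C X' C'' := by
  intro r hr
  obtain ⟨r', hr', n, c, hc, h⟩ := h r hr
  exact ⟨r', hr', n, c, hc, fun x hx =>
    (h x hx).trans (measure_mono (box_mono hC (by positivity) le_rfl))⟩

/-- The randomness `ρ` of the ring does not depend on the state, so its total mass is a lower bound
that is uniform over the box. -/
theorem Reach.of_ring [Finite S] {Θ : Type} [MeasurableSpace Θ] {X X' : Fin M → S}
    {C C' : Set (S ⊕ Fin M)} (ρ : Measure Θ) (hρ : ρ ≠ 0) {z : State S M → Θ → State S M}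
    (hz : ∀ x, Measurable (z x)) (hle : ∀ x, x.2.2 = X → ρ.map (z x) ≤ ringKernel S τ M x)
    (hbox : ∀ r : ℝ≥0, 1 ≤ r → ∃ r' : ℝ≥0, 1 ≤ r' ∧ ∀ x ∈ box X C r,
      ∀ᵐ θ ∂ρ, z x θ ∈ box X' C' r') : Reach τ X C X' C' := by
  intro r hr
  obtain ⟨r', hr', h⟩ := hbox r hr
  refine ⟨r', hr', 1, ρ Set.univ, by simpa using hρ, fun x hx => ?_⟩
  rw [_root_.pow_one]
  refine le_trans ?_ (hle x hx.1 _)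
  rw [Measure.map_apply (hz x) (measurableSet_box _ _ _)]
  exact (measure_congr (eventuallyEq_univ.2 (h x hx))).ge

/-- A coupling argument: two states that agree outside `A` are driven by the same `θ`, agree outside
`A'` after the ring, and are then not distinguished by `Γ`. Itineraries are thus built backwards in
time, each use adding an earlier ring. -/
theorem Minorized.of_ring [Finite S] {X X' : Fin M → S} {A A' : Set (S ⊕ Fin M)}
    (h : Minorized τ X' A')
    (hring : ∀ r : ℝ≥0, 1 ≤ r → ∃ (Θ : Type) (_ : MeasurableSpace Θ) (ρ : Measure Θ)
      (z : State S M → Θ → State S M) (r' : ℝ≥0), SFinite ρ ∧ ρ ≠ 0 ∧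
      (Measurable fun q : State S M × Θ => z q.1 q.2) ∧ 1 ≤ r' ∧
      (∀ x ∈ box X Set.univ r, ρ.map (z x) ≤ ringKernel S τ M x) ∧
      (∀ x ∈ box X Set.univ r, ∀ᵐ θ ∂ρ, z x θ ∈ box X' Set.univ r') ∧
      ∀ x ∈ box X Set.univ r, ∀ y ∈ box X Set.univ r,
        (∀ i, i ∉ A → energy x i = energy y i) →
        ∀ᵐ θ ∂ρ, ∀ i, i ∉ A' → energy (z x θ) i = energy (z y θ) i) :
    Minorized τ X A := by
  intro r hr
  obtain ⟨Θ, _, ρ, z, r', hρs, hρ, hz, hr', hle, hbox, hagree⟩ := hring r hr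
  obtain ⟨n, Γ, hΓ0, hΓ, hΓle⟩ := h r' hr'
  let κ : Kernel (State S M) (State S M) := ⟨fun x => ρ.map (z x), measurable_map_of_uncurry ρ hz⟩
  have hzx : ∀ x, Measurable (z x) := fun x => hz.comp measurable_prodMk_left
  have happ : ∀ x B, MeasurableSet B → (Γ ∘ₖ κ) x B = ∫⁻ θ, Γ (z x θ) B ∂ρ := by
    intro x B hB
    rw [Kernel.comp_apply' _ _ _ hB]
    exact lintegral_map (Kernel.measurable_coe Γ hB) (hzx x)
  refine ⟨1 + n, Γ ∘ₖ κ, fun x hx h0 => ?_, fun x hx y hy hxy => ?_, fun x hx => ?_⟩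
  · have h1 : ∫⁻ θ, Γ (z x θ) Set.univ ∂ρ = 0 := by
      rw [← happ x _ MeasurableSet.univ, h0]; rfl
    have hm : Measurable fun θ => Γ (z x θ) Set.univ :=
      (Kernel.measurable_coe Γ MeasurableSet.univ).comp (hzx x)
    rw [lintegral_eq_zero_iff hm] at h1
    have h2 : ∀ᵐ θ ∂ρ, False := by
      filter_upwards [h1, hbox x hx] with θ hθ hθ'
      exact hΓ0 _ hθ' (Measure.measure_univ_eq_zero.1 hθ)
    exact hρ (by simpa using h2)
  · ext B hB
    rw [happ x B hB, happ y B hB]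
    refine lintegral_congr_ae ?_
    filter_upwards [hbox x hx, hbox y hy, hagree x hx y hy hxy] with θ h1 h2 h3
    rw [hΓ _ h1 _ h2 h3]
  · refine Measure.le_iff.2 fun B hB => ?_
    rw [happ x B hB, Kernel.pow_add_apply_eq_lintegral _ _ _ _ hB,
      _root_.pow_one]
    calc ∫⁻ θ, Γ (z x θ) B ∂ρ ≤ ∫⁻ θ, (ringKernel S τ M ^ n) (z x θ) B ∂ρ := by
          refine lintegral_mono_ae ?_
          filter_upwards [hbox x hx] with θ hθ
          exact hΓle _ hθ B
      _ = ∫⁻ y, (ringKernel S τ M ^ n) y B ∂ρ.map (z x) :=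
          (lintegral_map (Kernel.measurable_coe _ hB) (hzx x)).symm
      _ ≤ _ := lintegral_mono' (hle x hx) le_rfl

/-- The end of every itinerary: with no rings left nothing can be forgotten. -/
theorem Minorized.refl [Finite S] (X : Fin M → S) : Minorized τ X ∅ := by
  intro r hr
  refine ⟨0, Kernel.id, fun x _ => ?_, fun x hx y hy h => ?_, fun x _ => le_of_eq rfl⟩
  · rw [Kernel.id_apply]; exact NeZero.ne _
  · rw [State.ext_energy (hx.1.trans hy.1.symm) (funext fun i => h i (Set.notMem_empty i))]

end Accessibility

/-! ### Single rings as building blocks of itineraries. -/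

section Rings

variable {d : ℕ} {S : Set (Fin d → ℤ)} {τ : (Fin d → ℤ) → ℝ} {M : ℕ}

/-- The law of the fraction at a ring, restricted to the middle third, times the probability of the
choice of the particle and of the direction. -/
def middleMeasure (d M : ℕ) : Measure ℝ :=
  choiceProb d M • volume.restrict (Set.Icc (1 / 3 : ℝ) (2 / 3))

theorem middleMeasure_ne_zero (d M : ℕ) : middleMeasure d M ≠ 0 := by
  intro h
  have := congrArg (fun m => m Set.univ) h
  simp [middleMeasure, choiceProb_ne_zero] at this
  norm_num at this

theorem ae_middleMeasure (d M : ℕ) : ∀ᵐ p ∂middleMeasure d M, p ∈ Set.Icc (1 / 3 : ℝ) (2 / 3) :=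
  Measure.ae_smul_measure (ae_restrict_mem measurableSet_Icc) _

theorem restrict_middle_le :
    (volume : Measure ℝ).restrict (Set.Icc (1 / 3 : ℝ) (2 / 3)) ≤
      volume.restrict (Set.Icc (0 : ℝ) 1) :=
  Measure.restrict_mono (Set.Icc_subset_Icc (by norm_num) (by norm_num)) le_rfl

theorem map_middleMeasure_le {x : State S M} {k : Fin M} {w : S}
    (h : (latticeGraph d).Adj (x.2.2 k) w) :
    (middleMeasure d M).map (jumpInside x k w) ≤ ringKernel S τ M x := by
  refine le_trans ?_ (smul_map_jumpInside_le h)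
  rw [middleMeasure, Measure.map_smul]
  refine Measure.le_iff.2 fun A hA => ?_
  simp only [Measure.smul_apply, smul_eq_mul]
  gcongr 1
  exact Measure.map_mono restrict_middle_le (measurable_jumpInside_right x k w) A

theorem Reach.inside [Finite S] {X : Fin M → S} {C C' : Set (S ⊕ Fin M)} {k : Fin M} {w : S}
    (h : (latticeGraph d).Adj (X k) w)
    (hC : ∀ i ∈ C', i ∈ C ∨ i = Sum.inl (X k) ∧ Sum.inr k ∈ C) :
    Reach τ X C (Function.update X k w) C' := by
  refine Reach.of_ring (middleMeasure d M) (middleMeasure_ne_zero d M)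
    (z := fun x p => jumpInside x k w p) (fun x => measurable_jumpInside_right x k w)
    (fun x hx => map_middleMeasure_le (by rw [hx]; exact h)) fun r hr => ⟨3 * r, ?_, ?_⟩
  · exact hr.trans (le_mul_of_one_le_left' (by norm_num))
  · intro x hx
    filter_upwards [ae_middleMeasure d M] with p hp
    exact jumpInside_mem_box hr hC hx w hp

theorem Reach.jump_bath [Finite S] (hτ : ∀ w ∈ bath S, 0 < τ w) {X : Fin M → S}
    {C C' : Set (S ⊕ Fin M)} {k : Fin M} {a : Fin d × Bool}
    (h : (X k : Fin d → ℤ) + unitStep a ∈ bath S)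
    (hC : ∀ i ∈ C', i ∈ C ∨ i = Sum.inr k ∨ i = Sum.inl (X k) ∧ Sum.inr k ∈ C) :
    Reach τ X C X C' := by
  obtain ⟨c, hc0, -, hc⟩ := exists_smul_map_jumpBath_le (M := M) hτ h
  have hae : ∀ᵐ q ∂((c * choiceProb d M) •
      ((volume : Measure ℝ).restrict (Set.Icc (1 / 3 : ℝ) (2 / 3))).prod
        ((volume : Measure ℝ).restrict (Set.Icc (1 : ℝ) 2))),
        q ∈ Set.Icc (1 / 3 : ℝ) (2 / 3) ×ˢ Set.Icc (1 : ℝ) 2 := by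
    refine Measure.ae_smul_measure ?_ _
    rw [Measure.prod_restrict]
    exact ae_restrict_mem (measurableSet_Icc.prod measurableSet_Icc)
  refine Reach.of_ring ((c * choiceProb d M) • ((volume.restrict (Set.Icc (1 / 3 : ℝ) (2 / 3))).prod
    (volume.restrict (Set.Icc (1 : ℝ) 2)))) ?_ (z := fun x (q : ℝ × ℝ) => jumpBath x k q.1 q.2)
    (fun x => measurable_jumpBath_right x k) (fun x hx => ?_) fun r hr => ⟨3 * r, ?_, ?_⟩
  · intro h
    have := congrArg (fun m => m Set.univ) h
    simp [← Set.univ_prod_univ, Measure.prod_prod, choiceProb_ne_zero, hc0] at this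
    norm_num at this
  · refine le_trans ?_ (hc k x (by rw [hx]))
    rw [Measure.map_smul]
    refine Measure.le_iff.2 fun A hA => ?_
    simp only [Measure.smul_apply, smul_eq_mul]
    gcongr 1
    exact Measure.map_mono (Measure.prod_mono restrict_middle_le le_rfl)
      (measurable_jumpBath_right x k) A
  · exact hr.trans (le_mul_of_one_le_left' (by norm_num))
  · intro x hx
    filter_upwards [hae] with q hq
    exact jumpBath_mem_box hr hC hx hq.1 hq.2

/-- Driven by the same `p`, the two states acquire new differences only in the two coordinates
involved, and these will be forgotten anyway. The site at which the particle arrives is not touched.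
-/
theorem Minorized.inside [Finite S] {X : Fin M → S} {A : Set (S ⊕ Fin M)} {k : Fin M} {w : S}
    (h : (latticeGraph d).Adj (X k) w) (hk : Sum.inr k ∈ A) (hX : Sum.inl (X k) ∈ A)
    (hA : Minorized τ (Function.update X k w) A) : Minorized τ X A := by
  refine hA.of_ring fun r hr => ⟨ℝ, inferInstance, middleMeasure d M,
    fun x p => jumpInside x k w p, 3 * r, ?_, middleMeasure_ne_zero d M,
    measurable_jumpInside_uncurry k w, ?_, fun x hx => ?_, fun x hx => ?_, fun x hx y hy hxy => ?_⟩
  · unfold middleMeasure; infer_instance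
  · exact hr.trans (le_mul_of_one_le_left' (by norm_num))
  · exact map_middleMeasure_le (by rw [hx.1]; exact h)
  · filter_upwards [ae_middleMeasure d M] with p hp
    exact jumpInside_mem_box hr (fun i hi => Or.inl hi) hx w hp
  · refine Eventually.of_forall fun p i hi => ?_
    have h1 : i ≠ Sum.inl (X k) := fun h => hi (h ▸ hX)
    have h2 : i ≠ Sum.inr k := fun h => hi (h ▸ hk)
    dsimp only
    rw [energy_jumpInside, energy_jumpInside, hx.1, hy.1, if_neg h1, if_neg h1, if_neg h2,
      if_neg h2, hxy i hi]

/-- A fixed range of energies that a site can keep at a ring, whatever the state in the box. -/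
def keptRange (r : ℝ≥0) : Set ℝ := Set.Icc ((2 * r)⁻¹ : ℝ) ((r : ℝ)⁻¹)

theorem volume_keptRange_ne_zero {r : ℝ≥0} (hr : 1 ≤ r) : volume (keptRange r) ≠ 0 := by
  have hr0 : (0 : ℝ) < r := lt_of_lt_of_le one_pos (by exact_mod_cast hr)
  rw [keptRange, Real.volume_Icc, ne_eq, ENNReal.ofReal_eq_zero, not_le, mul_inv]
  have : (0 : ℝ) < (r : ℝ)⁻¹ := by positivity
  linarith

/-- The law of the energy kept by the site, restricted to `keptRange r`, up to a constant. -/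
def keptMeasure (r : ℝ≥0) : Measure ℝ :=
  ENNReal.ofReal (2 * r : ℝ)⁻¹ • volume.restrict (keptRange r)

theorem keptMeasure_univ_ne_zero {r : ℝ≥0} (hr : 1 ≤ r) : keptMeasure r Set.univ ≠ 0 := by
  have hr0 : (0 : ℝ) < r := lt_of_lt_of_le one_pos (by exact_mod_cast hr)
  simp only [keptMeasure, Measure.smul_apply, Measure.restrict_apply_univ, smul_eq_mul]
  refine mul_ne_zero ?_ (volume_keptRange_ne_zero hr)
  rw [ne_eq, ENNReal.ofReal_eq_zero, not_le]
  positivity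

theorem ae_keptMeasure (r : ℝ≥0) : ∀ᵐ s ∂keptMeasure r, s ∈ keptRange r :=
  Measure.ae_smul_measure (ae_restrict_mem measurableSet_Icc) _

instance sFinite_keptMeasure (r : ℝ≥0) : SFinite (keptMeasure r) := by
  unfold keptMeasure; infer_instance

theorem kept_bounds {r : ℝ≥0} {X : Fin M → S} {x : State S M}
    (hx : x ∈ box X Set.univ r) (k : Fin M) :
    2 * (r : ℝ)⁻¹ ≤ pooled x k ∧ (pooled x k : ℝ) ≤ 2 * r := by
  constructor
  · have h1 := hx.2.1 (Sum.inl (x.2.2 k)) (Set.mem_univ _)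
    have h2 := hx.2.1 (Sum.inr k) (Set.mem_univ _)
    have h3 : r⁻¹ + r⁻¹ ≤ pooled x k := by rw [pooled_eq]; exact add_le_add h1 h2
    rw [two_mul]
    exact_mod_cast h3
  · exact_mod_cast pooled_le hx k

/-- If `p` is uniform, the kept energy `p * E` has the density `E⁻¹ ≥ (2 * r)⁻¹` on `[0, E]`, and
this interval contains `keptRange r` because `(r : ℝ)⁻¹ ≤ E / 2`. -/
theorem map_keptMeasure_le {r : ℝ≥0} (hr : 1 ≤ r) {E : ℝ} (hE1 : 2 * (r : ℝ)⁻¹ ≤ E)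
    (hE2 : E ≤ 2 * r) :
    (keptMeasure r).map (fun s => s * E⁻¹) ≤ volume.restrict (Set.Icc (0 : ℝ) 1) := by
  have hr0 : (0 : ℝ) < r := lt_of_lt_of_le one_pos (by exact_mod_cast hr)
  have hri : (0 : ℝ) < (r : ℝ)⁻¹ := by positivity
  have hE0 : 0 < E := by linarith
  refine Measure.le_iff.2 fun A hA => ?_
  have hm : Measurable fun s : ℝ => s * E⁻¹ := by fun_prop
  rw [Measure.map_apply hm hA, keptMeasure, Measure.smul_apply, smul_eq_mul,
    Measure.restrict_apply (hm hA), Measure.restrict_apply hA]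
  have hsub : (fun s => s * E⁻¹) ⁻¹' A ∩ keptRange r ⊆
      (fun s => s * E⁻¹) ⁻¹' (A ∩ Set.Icc 0 1) := by
    rintro s ⟨hs, hs1, hs2⟩
    have h0 : 0 ≤ s := le_trans (by positivity) hs1
    refine ⟨hs, by positivity, ?_⟩
    change s * E⁻¹ ≤ 1
    rw [← div_eq_mul_inv, div_le_one hE0]
    linarith
  calc ENNReal.ofReal (2 * r : ℝ)⁻¹ * volume ((fun s => s * E⁻¹) ⁻¹' A ∩ keptRange r)
      ≤ ENNReal.ofReal (2 * r : ℝ)⁻¹ * volume ((fun s => s * E⁻¹) ⁻¹' (A ∩ Set.Icc 0 1)) := by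
        gcongr
    _ = ENNReal.ofReal ((2 * r : ℝ)⁻¹ * E) * volume (A ∩ Set.Icc 0 1) := by
        rw [Real.volume_preimage_mul_right (by positivity), inv_inv, abs_of_pos hE0,
          ← mul_assoc, ENNReal.ofReal_mul (by positivity)]
    _ ≤ 1 * volume (A ∩ Set.Icc 0 1) := by
        gcongr
        rw [ENNReal.ofReal_le_one, inv_mul_le_iff₀ (by positivity)]
        linarith
    _ = volume (A ∩ Set.Icc 0 1) := one_mul _

theorem kept_eq {s : ℝ} {q : ℝ≥0} (hq : 0 < q) :
    (s * (q : ℝ)⁻¹).toNNReal * q = s.toNNReal := by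
  rw [mul_comm s, Real.toNNReal_mul (by positivity), ← NNReal.coe_inv, Real.toNNReal_coe,
    mul_right_comm, inv_mul_cancel₀ hq.ne', one_mul]

/-- The kept energy is at most half of the pooled energy, so the particle takes at least half. -/
theorem kept_fraction {r q : ℝ≥0} (hr : 1 ≤ r) (hq : 2 * (r : ℝ)⁻¹ ≤ q) {s : ℝ}
    (hs : s ∈ keptRange r) : 0 < q ∧ (3 * r)⁻¹ ≤ s.toNNReal ∧ (s * (q : ℝ)⁻¹).toNNReal ≤ 1 ∧
      3⁻¹ ≤ (1 - s * (q : ℝ)⁻¹).toNNReal ∧ (1 - s * (q : ℝ)⁻¹).toNNReal ≤ 1 := by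
  have hr0 : (0 : ℝ) < r := lt_of_lt_of_le one_pos (by exact_mod_cast hr)
  have hri : (0 : ℝ) < (r : ℝ)⁻¹ := by positivity
  have hq0 : (0 : ℝ) < q := by linarith
  obtain ⟨h1, h2⟩ := hs
  have hs0 : 0 < s := lt_of_lt_of_le (by positivity) h1
  have hf : s * (q : ℝ)⁻¹ ≤ 1 / 2 := by
    rw [← div_eq_mul_inv, div_le_iff₀ hq0]
    linarith
  have hf0 : 0 ≤ s * (q : ℝ)⁻¹ := by positivity
  refine ⟨by exact_mod_cast hq0, ?_, ?_, ?_, ?_⟩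
  · rw [Real.le_toNNReal_iff_coe_le hs0.le]
    refine le_trans ?_ h1
    push_cast
    gcongr
    norm_num
  · rw [Real.toNNReal_le_one]; linarith
  · rw [Real.le_toNNReal_iff_coe_le (by linarith)]; push_cast; linarith
  · rw [Real.toNNReal_le_one]; linarith

theorem measurable_pooled (k : Fin M) : Measurable fun x : State S M => pooled x k := by
  have key : Measurable fun q : ((S → ℝ≥0) × (Fin M → ℝ≥0)) × (Fin M → S) =>
      pooled ((q.1.1, q.1.2, q.2) : State S M) k :=
    measurable_from_prod_countable_left fun X => by
      change Measurable fun y : (S → ℝ≥0) × (Fin M → ℝ≥0) => y.1 (X k) + y.2 k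
      fun_prop
  exact key.comp (show Measurable fun x : State S M => ((x.1, x.2.1), x.2.2) by fun_prop)

/-- A ring at which the energy of the site gets a density. -/
theorem Minorized.settle [Finite S] (hd : 0 < d) (hM : 0 < M) {X : Fin M → S}
    {A : Set (S ⊕ Fin M)} {k : Fin M} {w : S}
    (h : (latticeGraph d).Adj (X k) w) (hk : Sum.inr k ∈ A)
    (hA : Minorized τ (Function.update X k w) A) :
    Minorized τ X (insert (Sum.inl (X k)) A) := by
  refine hA.of_ring fun r hr => ⟨ℝ, inferInstance, choiceProb d M • keptMeasure r,
    -- The parameter is the energy `s` kept by the site, so both states get the same site energy.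
    -- The particle takes the rest, which remembers the past; hence its coordinate must already
    -- belong to `A`.
    fun x s => jumpInside x k w (s * (pooled x k : ℝ)⁻¹), 3 * r, ?_, fun h0 => ?_,
    ?_, ?_, fun x hx => ?_, fun x hx => ?_, fun x hx y hy hxy => ?_⟩
  · have := choiceProb_ne_top hd hM
    infer_instance
  · have := congrArg (fun m => m Set.univ) h0
    simp [choiceProb_ne_zero, keptMeasure_univ_ne_zero hr] at this
  · have hp := measurable_pooled (S := S) k
    exact (measurable_jumpInside_uncurry k w).comp (show Measurable fun q : State S M × ℝ =>
      (q.1, q.2 * (pooled q.1 k : ℝ)⁻¹) by fun_prop)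
  · exact hr.trans (le_mul_of_one_le_left' (by norm_num))
  · obtain ⟨h1, h2⟩ := kept_bounds hx k
    refine le_trans ?_ (smul_map_jumpInside_le (by rw [hx.1]; exact h))
    rw [Measure.map_smul]
    refine Measure.le_iff.2 fun B hB => ?_
    simp only [Measure.smul_apply, smul_eq_mul]
    gcongr 1
    have e : (keptMeasure r).map (fun s => jumpInside x k w (s * (pooled x k : ℝ)⁻¹)) =
        ((keptMeasure r).map fun s => s * (pooled x k : ℝ)⁻¹).map (jumpInside x k w) :=
      (Measure.map_map (measurable_jumpInside_right x k w) (by fun_prop)).symm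
    rw [e]
    exact Measure.map_mono (map_keptMeasure_le hr h1 h2) (measurable_jumpInside_right x k w) B
  · filter_upwards [Measure.ae_smul_measure (ae_keptMeasure r) (choiceProb d M)] with s hs
    obtain ⟨hq, hs1, hs2, hs3, hs4⟩ := kept_fraction hr (kept_bounds hx k).1 hs
    have hr3 : r ≤ 3 * r := le_mul_of_one_le_left' (by norm_num)
    refine ⟨by rw [← hx.1]; rfl, fun i _ => ?_, fun i => ?_⟩
    · rw [energy_jumpInside]
      split_ifs
      · rwa [kept_eq hq]
      · exact le_mul_pooled hx k hs3 (Or.inl (Set.mem_univ _))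
      · exact (inv_anti₀ (by positivity) hr3).trans (hx.2.1 i (Set.mem_univ _))
    · rw [energy_jumpInside]
      split_ifs
      · exact mul_pooled_le hx k hs2
      · exact mul_pooled_le hx k hs4
      · exact (hx.2.2 i).trans hr3
  · filter_upwards [Measure.ae_smul_measure (ae_keptMeasure r) (choiceProb d M)] with s hs i hi
    have hqx := (kept_fraction hr (kept_bounds hx k).1 hs).1
    have hqy := (kept_fraction hr (kept_bounds hy k).1 hs).1
    have h2 : i ≠ Sum.inr k := fun h => hi (h ▸ hk)
    rw [energy_jumpInside, energy_jumpInside, hx.1, hy.1, kept_eq hqx, kept_eq hqy, if_neg h2,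
      if_neg h2]
    split_ifs with h1
    · rfl
    · exact hxy i fun h => (Set.mem_insert_iff.1 h).elim h1 hi

/-- A ring at which the energies of the site and of the particle get a joint density. -/
theorem Minorized.settle_bath [Finite S]
    (hτ : ∀ w ∈ bath S, 0 < τ w) {X : Fin M → S} {A : Set (S ⊕ Fin M)} {k : Fin M}
    {a : Fin d × Bool} (h : (X k : Fin d → ℤ) + unitStep a ∈ bath S) (hA : Minorized τ X A) :
    Minorized τ X (insert (Sum.inl (X k)) (insert (Sum.inr k) A)) := by
  obtain ⟨c, hc0, hct, hc⟩ := exists_smul_map_jumpBath_le (M := M) hτ h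
  have hae : ∀ r, ∀ᵐ q ∂((c * choiceProb d M) •
      (keptMeasure r).prod ((volume : Measure ℝ).restrict (Set.Icc (1 : ℝ) 2))),
        q ∈ keptRange r ×ˢ Set.Icc (1 : ℝ) 2 := by
    intro r
    refine Measure.ae_smul_measure ?_ _
    rw [keptMeasure, Measure.prod_smul_left, Measure.prod_restrict]
    exact Measure.ae_smul_measure (ae_restrict_mem (measurableSet_Icc.prod measurableSet_Icc)) _
  refine hA.of_ring fun r hr => ⟨ℝ × ℝ, inferInstance, (c * choiceProb d M) •
    (keptMeasure r).prod (volume.restrict (Set.Icc (1 : ℝ) 2)),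
    -- The kept energy and the energy from the bath are both parameters, so site and particle forget
    -- their past together.
    fun x q => jumpBath x k (q.1 * (pooled x k : ℝ)⁻¹) q.2, 3 * r, ?_, fun h0 => ?_,
    ?_, ?_, fun x hx => ?_, fun x hx => ?_, fun x hx y hy hxy => ?_⟩
  · infer_instance
  · have := congrArg (fun m => m Set.univ) h0
    simp [← Set.univ_prod_univ, Measure.prod_prod, choiceProb_ne_zero, hc0,
      keptMeasure_univ_ne_zero hr] at this
  · have hp := measurable_pooled (S := S) k
    exact (measurable_jumpBath_uncurry k).comp (show Measurable fun q : State S M × ℝ × ℝ =>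
      (q.1, q.2.1 * (pooled q.1 k : ℝ)⁻¹, q.2.2) by fun_prop)
  · exact hr.trans (le_mul_of_one_le_left' (by norm_num))
  · obtain ⟨h1, h2⟩ := kept_bounds hx k
    refine le_trans ?_ (hc k x (by rw [hx.1]))
    rw [Measure.map_smul]
    refine Measure.le_iff.2 fun B hB => ?_
    simp only [Measure.smul_apply, smul_eq_mul]
    gcongr 1
    have hm : Measurable fun s : ℝ => s * (pooled x k : ℝ)⁻¹ := by fun_prop
    have e : ((keptMeasure r).prod (volume.restrict (Set.Icc (1 : ℝ) 2))).map
        (fun q => jumpBath x k (q.1 * (pooled x k : ℝ)⁻¹) q.2) =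
        (((keptMeasure r).map fun s => s * (pooled x k : ℝ)⁻¹).prod
          (volume.restrict (Set.Icc (1 : ℝ) 2))).map fun q => jumpBath x k q.1 q.2 := by
      conv_rhs => rw [← Measure.map_id (μ := volume.restrict (Set.Icc (1 : ℝ) 2))]
      rw [Measure.map_prod_map _ _ hm measurable_id,
        Measure.map_map (measurable_jumpBath_right x k) (hm.prodMap measurable_id)]
      rfl
    rw [e]
    exact Measure.map_mono (Measure.prod_mono (map_keptMeasure_le hr h1 h2) le_rfl)
      (measurable_jumpBath_right x k) B
  · filter_upwards [hae r] with q hq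
    obtain ⟨hq0, hs1, hs2, -, -⟩ := kept_fraction hr (kept_bounds hx k).1 hq.1
    have hr3 : r ≤ 3 * r := le_mul_of_one_le_left' (by norm_num)
    have h31 : 1 ≤ 3 * r := hr.trans hr3
    have he2 : q.2.toNNReal ≤ 2 := by
      rw [Real.toNNReal_le_iff_le_coe]; exact_mod_cast hq.2.2
    refine ⟨hx.1, fun i _ => ?_, fun i => ?_⟩
    · rw [energy_jumpBath]
      split_ifs
      · rwa [kept_eq hq0]
      · refine (inv_le_one_of_one_le₀ h31).trans ?_
        rw [Real.one_le_toNNReal]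
        exact hq.2.1
      · exact (inv_anti₀ (by positivity) hr3).trans (hx.2.1 i (Set.mem_univ _))
    · rw [energy_jumpBath]
      split_ifs
      · exact mul_pooled_le hx k hs2
      · calc q.2.toNNReal ≤ 3 * 1 := he2.trans (by norm_num)
          _ ≤ 3 * r := by gcongr
      · exact (hx.2.2 i).trans hr3
  · filter_upwards [hae r] with q hq i hi
    have hqx := (kept_fraction hr (kept_bounds hx k).1 hq.1).1
    have hqy := (kept_fraction hr (kept_bounds hy k).1 hq.1).1
    rw [energy_jumpBath, energy_jumpBath, hx.1, hy.1, kept_eq hqx, kept_eq hqy]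
    split_ifs with h1 h2
    · rfl
    · rfl
    · refine hxy i fun h => ?_
      rcases Set.mem_insert_iff.1 h with h | h
      · exact h1 h
      · exact (Set.mem_insert_iff.1 h).elim h2 hi

end Rings

/-! ### Routes of the particles -/

section Routes

variable {d : ℕ} {S : Set (Fin d → ℤ)} {τ : (Fin d → ℤ) → ℝ} {M : ℕ}

theorem Reach.move [Finite S] (hS : ((latticeGraph d).induce S).Connected) (X : Fin M → S)
    (C : Set (S ⊕ Fin M)) (k : Fin M) (w : S) : Reach τ X C (Function.update X k w) C := by
  obtain ⟨p⟩ := hS.preconnected (X k) w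
  generalize hu : X k = u at p
  induction p generalizing X with
  | nil =>
    rw [← hu, Function.update_eq_self]
    exact Reach.refl X C
  | cons h p ih =>
    have h1 := Reach.inside (τ := τ) (X := X) (C := C) (C' := C) (k := k) (by rw [hu]; exact h)
      fun i hi => Or.inl hi
    have h2 := ih (Function.update X k _) (Function.update_self _ _ _)
    rw [Function.update_idem] at h2
    exact h1.trans h2

/-- The particle walks back after its task, so energizing coordinates need not change the positions.
-/
theorem Reach.of_excursion [Finite S] (hS : ((latticeGraph d).induce S).Connected) {X : Fin M → S}
    {C C' : Set (S ⊕ Fin M)} {k : Fin M} {w : S}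
    (h : Reach τ X C (Function.update X k w) C') : Reach τ X C X C' := by
  have h1 := Reach.move (τ := τ) hS (Function.update X k w) C' k (X k)
  rw [Function.update_idem, Function.update_eq_self] at h1
  exact h.trans h1

/-- The first step of a shortest walk. -/
theorem exists_adj_of_ne (hS : ((latticeGraph d).induce S).Connected) {v w : S} (h : v ≠ w) :
    ∃ u : S, (latticeGraph d).Adj v u ∧ ((latticeGraph d).induce S).dist u w <
      ((latticeGraph d).induce S).dist v w := by
  obtain ⟨p, hp⟩ := (hS.preconnected v w).exists_walk_length_eq_dist
  cases p with
  | nil => exact absurd rfl h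
  | cons hvu q =>
    refine ⟨_, hvu, ?_⟩
    rw [← hp, SimpleGraph.Walk.length_cons]
    exact Nat.lt_succ_of_le (SimpleGraph.dist_le q)

variable {v₀ : S} {a₀ : Fin d × Bool}

theorem Reach.energize_particle [Finite S] (hS : ((latticeGraph d).induce S).Connected)
    (hτ : ∀ w ∈ bath S, 0 < τ w) (h₀ : (v₀ : Fin d → ℤ) + unitStep a₀ ∈ bath S)
    (X : Fin M → S) (C : Set (S ⊕ Fin M)) (k : Fin M) :
    Reach τ X C X (insert (Sum.inr k) C) := by
  refine Reach.of_excursion hS (k := k) (w := v₀) ((Reach.move hS X C k v₀).trans ?_)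
  refine Reach.jump_bath hτ (k := k) (a := a₀) (by rwa [Function.update_self]) fun i hi => ?_
  rcases Set.mem_insert_iff.1 hi with h | h
  · exact Or.inr (Or.inl h)
  · exact Or.inl h

theorem Reach.energize_site [Finite S] (hS : ((latticeGraph d).induce S).Connected)
    (hτ : ∀ w ∈ bath S, 0 < τ w) (h₀ : (v₀ : Fin d → ℤ) + unitStep a₀ ∈ bath S)
    (X : Fin M → S) {C : Set (S ⊕ Fin M)} {k : Fin M} (hk : Sum.inr k ∈ C) (v : S) :
    Reach τ X C X (insert (Sum.inl v) C) := by
  refine Reach.of_excursion hS (k := k) (w := v) ((Reach.move hS X C k v).trans ?_)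
  set Y := Function.update X k v with hY
  have hYk : Y k = v := Function.update_self _ _ _
  -- If `v₀` is the only site it has no neighbour in `S`; there the energy is deposited during a
  -- jump to the bath.
  by_cases hv : v = v₀
  · refine Reach.jump_bath hτ (k := k) (a := a₀) (by rwa [hYk, hv]) fun i hi => ?_
    rcases Set.mem_insert_iff.1 hi with h | h
    · exact Or.inr (Or.inr ⟨by rw [hYk, h], hk⟩)
    · exact Or.inl h
  · obtain ⟨w, hw, -⟩ := exists_adj_of_ne hS hv
    refine Reach.of_excursion hS (k := k) (w := w) (Reach.inside (by rwa [hYk]) fun i hi => ?_)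
    rcases Set.mem_insert_iff.1 hi with h | h
    · exact Or.inr ⟨by rw [hYk, h], hk⟩
    · exact Or.inl h

theorem Reach.energize [Finite S] (hS : ((latticeGraph d).induce S).Connected)
    (hτ : ∀ w ∈ bath S, 0 < τ w) (h₀ : (v₀ : Fin d → ℤ) + unitStep a₀ ∈ bath S)
    (hM : 0 < M) (X : Fin M → S) (C : Set (S ⊕ Fin M)) (i : S ⊕ Fin M) :
    Reach τ X C X (insert i C) := by
  rcases i with v | k
  · exact ((Reach.energize_particle hS hτ h₀ X C ⟨0, hM⟩).trans
      (Reach.energize_site hS hτ h₀ X (Set.mem_insert _ _) v)).mono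
        (Set.insert_subset_insert (Set.subset_insert _ _))
  · exact Reach.energize_particle hS hτ h₀ X C k

/-- All coordinates are energized one by one, and then the particles are moved to `v₀`. -/
theorem Reach.gather [Finite S] (hS : ((latticeGraph d).induce S).Connected)
    (hτ : ∀ w ∈ bath S, 0 < τ w) (h₀ : (v₀ : Fin d → ℤ) + unitStep a₀ ∈ bath S)
    (hM : 0 < M) (X : Fin M → S) : Reach τ X ∅ (fun _ => v₀) Set.univ := by
  classical
  have := Fintype.ofFinite S
  have h1 : ∀ T : Finset (S ⊕ Fin M), Reach τ X ∅ X T := by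
    intro T
    induction T using Finset.induction_on with
    | empty => rw [Finset.coe_empty]; exact Reach.refl X ∅
    | insert i T _ ih =>
      rw [Finset.coe_insert]
      exact ih.trans (Reach.energize hS hτ h₀ hM X T i)
  have h2 : ∀ T : Finset (Fin M),
      Reach τ X Set.univ (fun k => if k ∈ T then v₀ else X k) Set.univ := by
    intro T
    induction T using Finset.induction_on with
    | empty => simpa using Reach.refl X Set.univ
    | insert k T hk ih =>
      convert ih.trans (Reach.move hS _ Set.univ k v₀) using 1
      funext j
      by_cases hj : j = k
      · subst hj; simp
      · simp [hj]
  have h1' := h1 Finset.univ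
  have h2' := h2 Finset.univ
  simp only [Finset.coe_univ, Finset.mem_univ, if_true] at h1' h2'
  exact h1'.trans h2'

/-- The itinerary is preceded by the walk of particle `k` from `u` to `v₀` along a shortest route,
which touches only sites that are forgotten later. -/
theorem Minorized.walk_to [Finite S] (hS : ((latticeGraph d).induce S).Connected)
    {A : Set (S ⊕ Fin M)} {k : Fin M} (hk : Sum.inr k ∈ A) {N : ℕ}
    (hN : ∀ u : S, ((latticeGraph d).induce S).dist u v₀ < N → Sum.inl u ∈ A)
    (h : Minorized τ (fun _ => v₀) A) (u : S) (hu : ((latticeGraph d).induce S).dist u v₀ < N) :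
    Minorized τ (Function.update (fun _ => v₀) k u) A := by
  induction hm : ((latticeGraph d).induce S).dist u v₀ using Nat.strong_induction_on
    generalizing u with
  | _ m ih =>
    by_cases huv : u = v₀
    · rw [huv]
      simpa using h
    · obtain ⟨w, hw, hwd⟩ := exists_adj_of_ne hS huv
      refine Minorized.inside (k := k) (w := w) (by rwa [Function.update_self]) hk
        (by rw [Function.update_self]; exact hN u hu) ?_
      rw [Function.update_idem]
      exact ih _ (hm ▸ hwd) w (hwd.trans hu) rfl

/-- The itinerary is preceded by the walk of particle `k` from `v₀` out to `u`. A ring touches only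
the site that is left, so `u` itself need not be in `A`. -/
theorem Minorized.walk_from [Finite S] (hS : ((latticeGraph d).induce S).Connected)
    {A : Set (S ⊕ Fin M)} {k : Fin M} (hk : Sum.inr k ∈ A) (u : S)
    (hN : ∀ w : S, ((latticeGraph d).induce S).dist w v₀ <
      ((latticeGraph d).induce S).dist u v₀ → Sum.inl w ∈ A)
    (h : Minorized τ (Function.update (fun _ => v₀) k u) A) : Minorized τ (fun _ => v₀) A := by
  induction hm : ((latticeGraph d).induce S).dist u v₀ using Nat.strong_induction_on
    generalizing u with
  | _ m ih =>
    by_cases huv : u = v₀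
    · rw [huv] at h
      simpa using h
    · obtain ⟨w, hw, hwd⟩ := exists_adj_of_ne hS huv
      refine ih _ (hm ▸ hwd) w (fun z hz => hN z (hz.trans hwd)) ?_ rfl
      refine Minorized.inside (k := k) (w := u) (by rw [Function.update_self]; exact hw.symm) hk
        (by rw [Function.update_self]; exact hN w hwd) ?_
      rwa [Function.update_idem]

/-- Each particle at `v₀` exchanges once with the bath. -/
theorem Minorized.particles [Finite S] (hM : 0 < M)
    (hτ : ∀ w ∈ bath S, 0 < τ w) (h₀ : (v₀ : Fin d → ℤ) + unitStep a₀ ∈ bath S) :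
    Minorized (M := M) τ (fun _ => v₀) (insert (Sum.inl v₀) (Set.range Sum.inr)) := by
  have h : ∀ T : Finset (Fin M), T.Nonempty →
      Minorized τ (fun _ => v₀) (insert (Sum.inl v₀) (Sum.inr '' (T : Set (Fin M)))) := by
    intro T hT
    induction hT using Finset.Nonempty.cons_induction with
    | singleton k =>
      simpa using (Minorized.refl (fun _ => v₀)).settle_bath hτ (k := k) h₀
    | cons k T hk hT ih =>
      have := ih.settle_bath hτ (k := k) h₀
      rw [Set.insert_comm (Sum.inr k), Set.insert_idem] at this
      rwa [Finset.coe_cons, Set.image_insert_eq]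
  have := h Finset.univ ⟨⟨0, hM⟩, Finset.mem_univ _⟩
  rwa [Finset.coe_univ, Set.image_univ] at this

theorem Minorized.all [Finite S] (hd : 0 < d) (hM : 0 < M)
    (hS : ((latticeGraph d).induce S).Connected)
    (hτ : ∀ w ∈ bath S, 0 < τ w) (h₀ : (v₀ : Fin d → ℤ) + unitStep a₀ ∈ bath S) :
    Minorized (M := M) τ (fun _ => v₀) Set.univ := by
  classical
  have := Fintype.ofFinite S
  set δ : S → ℕ := fun u => ((latticeGraph d).induce S).dist u v₀ with hδ
  have hδ0 : ∀ u, δ u = 0 ↔ u = v₀ := fun u => hS.dist_eq_zero_iff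
  have key : ∀ T : Finset S, v₀ ∈ T → (∀ v ∈ T, ∀ u, δ u < δ v → u ∈ T) →
      Minorized (M := M) τ (fun _ => v₀) (Sum.inl '' (T : Set S) ∪ Set.range Sum.inr) := by
    intro T
    -- `T` is the set of sites forgotten in the remaining rings. A site `v` at maximal distance is
    -- added by an earlier excursion: particle 0 walks out to `v`, settles the energy of `v` while
    -- jumping to a nearer site, and walks back. All other sites it touches are nearer than `v`,
    -- hence in `T`.
    induction T using Finset.induction_on_max_value δ with
    | empty => intro h; simp at h
    | insert v T hv hmax ih =>
      intro hv₀ hdown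
      rw [Finset.coe_insert, Set.image_insert_eq, Set.insert_union]
      by_cases hvv : v = v₀
      · have hT : T = ∅ := by
          refine Finset.eq_empty_of_forall_notMem fun u hu => ?_
          have h1 := hmax u hu
          rw [hvv, (hδ0 v₀).2 rfl, Nat.le_zero, hδ0] at h1
          exact hv (by rwa [hvv, ← h1])
        rw [hT, hvv]
        simpa using Minorized.particles (M := M) hM hτ h₀
      · have hv₀T : v₀ ∈ T := (Finset.mem_insert.1 hv₀).resolve_left (Ne.symm hvv)
        have hlt : ∀ u, δ u < δ v → u ∈ T := fun u hu =>
          (Finset.mem_insert.1 (hdown v (Finset.mem_insert_self _ _) u hu)).resolve_left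
            fun h => hu.ne (by rw [h])
        have h1 := ih hv₀T fun w hw u hu => hlt u (hu.trans_le (hmax w hw))
        have hk : Sum.inr (⟨0, hM⟩ : Fin M) ∈ Sum.inl '' (T : Set S) ∪ Set.range Sum.inr :=
          Or.inr ⟨_, rfl⟩
        have hmem : ∀ u, δ u < δ v →
            (Sum.inl u : S ⊕ Fin M) ∈ Sum.inl '' (T : Set S) ∪ Set.range Sum.inr :=
          fun u hu => Or.inl ⟨u, hlt u hu, rfl⟩
        obtain ⟨w, hw, hwd⟩ := exists_adj_of_ne hS hvv
        have h2 := Minorized.walk_to hS hk hmem h1 w hwd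
        have h3 : Minorized τ (Function.update (fun _ => v₀) ⟨0, hM⟩ v)
            (insert (Sum.inl v) (Sum.inl '' (T : Set S) ∪ Set.range Sum.inr)) := by
          have := Minorized.settle (τ := τ) hd hM
            (X := Function.update (fun _ => v₀) (⟨0, hM⟩ : Fin M) v) (k := ⟨0, hM⟩) (w := w)
            (by rwa [Function.update_self]) hk (by rwa [Function.update_idem])
          rwa [Function.update_self] at this
        exact Minorized.walk_from hS (Or.inr hk) v (fun u hu => Or.inr (hmem u hu)) h3
  have := key Finset.univ (Finset.mem_univ _) fun _ _ _ _ => Finset.mem_univ _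
  rwa [Finset.coe_univ, Set.image_univ, Set.range_inl_union_range_inr] at this

end Routes

/-! ### Small sets of the continuous-time process. -/

section Minorization

variable {d : ℕ} {S : Set (Fin d → ℤ)} {τ : (Fin d → ℤ) → ℝ} {M : ℕ}

/-- The contribution of the event that exactly `n` clocks ring. -/
theorem poissonMeasure_smul_le_transition (t : ℝ≥0) (n : ℕ) (x : State S M) :
    poissonMeasure (M * t) {n} • (ringKernel S τ M ^ n) x ≤ transition S τ M t x := by
  refine Measure.le_iff.2 fun A hA => ?_
  rw [transition_apply _ _ _ _ _ hA, Measure.smul_apply, smul_eq_mul, mul_comm]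
  calc (ringKernel S τ M ^ n) x A * poissonMeasure (M * t) {n}
      = ∫⁻ m in {n}, (ringKernel S τ M ^ m) x A ∂poissonMeasure (M * t) := by
        rw [lintegral_singleton]
    _ ≤ _ := setLIntegral_le_lintegral _ _

theorem poissonMeasure_singleton_ne_zero (hM : 0 < M) (n : ℕ) :
    poissonMeasure (M * (1 : ℝ≥0)) {n} ≠ 0 := by
  have h := poissonMeasure_real_singleton_pos n
    (show (0 : ℝ≥0) < M * (1 : ℝ≥0) by rw [mul_one]; exact_mod_cast hM)
  intro h0
  rw [measureReal_def, h0] at h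
  simp at h

/-- The states with bounded energies form a small set. -/
theorem exists_le_transition [Finite S] (hd : 0 < d) (hM : 0 < M)
    (hS : ((latticeGraph d).induce S).Connected) (hτ : ∀ w ∈ bath S, 0 < τ w)
    {v₀ : S} {a₀ : Fin d × Bool} (h₀ : (v₀ : Fin d → ℤ) + unitStep a₀ ∈ bath S) (R : ℝ≥0) :
    ∃ ν : Measure (State S M), ν ≠ 0 ∧
      ∀ x, (∀ i, energy x i ≤ R) → ν ≤ transition S τ M 1 x := by
  classical
  have := Fintype.ofFinite S
  -- The number of rings and the constants depend on the initial positions, of which there are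
  -- finitely many: the radii are summed below, and `b` is a minimum.
  choose r' hr' m c hc hreach using fun X : Fin M → S =>
    Reach.gather (τ := τ) hS hτ h₀ hM X (max R 1) (le_max_right _ _)
  set r : ℝ≥0 := 1 + ∑ X, r' X with hr
  have hrX : ∀ X, r' X ≤ r := fun X =>
    (Finset.single_le_sum (fun _ _ => zero_le) (Finset.mem_univ X)).trans le_add_self
  obtain ⟨n, Γ, hΓ0, hΓ, hΓle⟩ := Minorized.all hd hM hS hτ h₀ r le_self_add
  have hbox : ∀ x : State S M, (∀ i, energy x i ≤ R) →
      c x.2.2 ≤ (ringKernel S τ M ^ m x.2.2) x (box (fun _ => v₀) Set.univ r) := fun x hx =>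
    (hreach x.2.2 x ⟨rfl, fun i hi => absurd hi (Set.notMem_empty i),
      fun i => (hx i).trans (le_max_left _ _)⟩).trans
        (measure_mono (box_mono le_rfl (lt_of_lt_of_le one_pos (hr' _)) (hrX _)))
  -- `Γ` is the same measure at all points of the box, so any point represents it. The box is
  -- nonempty since it is reached with positive probability.
  obtain ⟨y, hy⟩ : (box (fun _ : Fin M => v₀) Set.univ r).Nonempty := by
    rw [Set.nonempty_iff_ne_empty]
    intro h
    have h1 := hbox (0, 0, fun _ => v₀) fun i => by rcases i with v | k <;> simp [energy]
    rw [h, measure_empty] at h1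
    exact hc _ (le_antisymm h1 zero_le)
  set b : ℝ≥0∞ := Finset.univ.inf fun X =>
    poissonMeasure (M * (1 : ℝ≥0)) {m X + n} * c X with hb
  refine ⟨b • Γ y, ?_, fun x hx => Measure.le_iff.2 fun B hB => ?_⟩
  · have hb0 : 0 < b := (Finset.lt_inf_iff ENNReal.zero_lt_top).2 fun X _ =>
      pos_iff_ne_zero.2 (mul_ne_zero (poissonMeasure_singleton_ne_zero hM _) (hc X))
    intro h
    have h1 := congrArg (fun μ => μ Set.univ) h
    simp only [Measure.smul_apply, smul_eq_mul, Measure.coe_zero, Pi.zero_apply, mul_eq_zero,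
      Measure.measure_univ_eq_zero] at h1
    exact h1.elim hb0.ne' (hΓ0 y hy)
  · have h1 : Γ y B * c x.2.2 ≤ (ringKernel S τ M ^ (m x.2.2 + n)) x B :=
      mul_le_pow_add _ hB (hbox x hx) fun z hz => by
        rw [hΓ y hy z hz fun i hi => absurd (Set.mem_univ i) hi]
        exact hΓle z hz B
    calc (b • Γ y) B = b * Γ y B := rfl
      _ ≤ (poissonMeasure (M * (1 : ℝ≥0)) {m x.2.2 + n} * c x.2.2) * Γ y B := by
          gcongr
          exact Finset.inf_le (f := fun X =>
            poissonMeasure (M * (1 : ℝ≥0)) {m X + n} * c X) (Finset.mem_univ x.2.2)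
      _ = poissonMeasure (M * (1 : ℝ≥0)) {m x.2.2 + n} * (Γ y B * c x.2.2) := by
          rw [mul_assoc, mul_comm (c _)]
      _ ≤ poissonMeasure (M * (1 : ℝ≥0)) {m x.2.2 + n} *
            (ringKernel S τ M ^ (m x.2.2 + n)) x B := by gcongr
      _ ≤ transition S τ M 1 x B := poissonMeasure_smul_le_transition 1 _ x B

end Minorization

/-! ### The drift of the total energy -/

/-- The variable times the exponential density is `β⁻¹` times the Gamma density of shape 2. -/
theorem lintegral_ofReal_expMeasure {β : ℝ} (hβ : 0 < β) :
    ∫⁻ e, ENNReal.ofReal e ∂expMeasure β = ENNReal.ofReal β⁻¹ := by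
  change ∫⁻ e, ENNReal.ofReal e ∂volume.withDensity (exponentialPDF β) = _
  rw [lintegral_withDensity_eq_lintegral_mul _
    (show Measurable (exponentialPDF β) from (measurable_exponentialPDFReal β).ennreal_ofReal)
    (by fun_prop)]
  have h : ∀ e, (exponentialPDF β * fun e => ENNReal.ofReal e) e =
      ENNReal.ofReal β⁻¹ * gammaPDF 2 β e := by
    intro e
    simp only [Pi.mul_apply]
    by_cases he : 0 ≤ e
    · rw [exponentialPDF_of_nonneg he, gammaPDF_of_nonneg he, ← ENNReal.ofReal_mul (by positivity),
        ← ENNReal.ofReal_mul (by positivity)]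
      congr 1
      have h1 : (2 : ℝ) - 1 = 1 := by norm_num
      rw [h1, Real.rpow_one, Real.Gamma_two, Real.rpow_two]
      field_simp
    · rw [exponentialPDF_of_neg (not_le.1 he), gammaPDF_of_neg (not_le.1 he), zero_mul, mul_zero]
  rw [lintegral_congr h, lintegral_const_mul _
    (show Measurable (gammaPDF 2 β) from (measurable_gammaPDFReal 2 β).ennreal_ofReal),
    lintegral_gammaPDF_eq_one two_pos hβ, mul_one]

theorem lintegral_natCast_poissonMeasure_lt_top (r : ℝ≥0) :
    ∫⁻ n, (n : ℝ≥0∞) ∂poissonMeasure r < ∞ := by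
  have h : Integrable (fun n : ℕ => (n : ℝ)) (poissonMeasure r) := by
    rw [integrable_poissonMeasure_iff, ← summable_nat_add_iff 1]
    refine ((Real.summable_pow_div_factorial r).mul_left (Real.exp (-r) * r)).congr fun n => ?_
    rw [Nat.factorial_succ, Real.norm_natCast]
    push_cast
    field_simp
    ring
  have := h.lintegral_lt_top
  simpa using this

section Drift

variable {d : ℕ} {S : Set (Fin d → ℤ)} {τ : (Fin d → ℤ) → ℝ} {M : ℕ}

theorem sum_update_add {ι : Type*} [Fintype ι] [DecidableEq ι] (f : ι → ℝ≥0) (i : ι) (a : ℝ≥0) :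
    ∑ j, Function.update f i a j + f i = ∑ j, f j + a := by
  rw [Finset.sum_update_of_mem (Finset.mem_univ i), ← Finset.add_sum_erase _ f (Finset.mem_univ i),
    ← Finset.sdiff_singleton_eq_erase]
  ring

theorem third_energy_le_jumpInside (x : State S M) (k : Fin M) (w : S) (i : S ⊕ Fin M) {p : ℝ}
    (hp : p ∈ Set.Icc (1 / 3 : ℝ) (2 / 3)) :
    3⁻¹ * energy x i ≤ energy (jumpInside x k w p) i := by
  obtain ⟨h1, -, h2, -⟩ := third_le hp
  rw [energy_jumpInside]
  split_ifs with h h'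
  · rw [pooled_eq, h]
    exact mul_le_mul' h1 le_self_add
  · rw [pooled_eq, h']
    exact mul_le_mul' h2 le_add_self
  · exact mul_le_of_le_one_left zero_le (inv_le_one_of_one_le₀ (by norm_num))

/-- This is how the energy of a site is put onto a particle that can carry it to the bath. -/
theorem third_energy_le_jumpInside_particle (x : State S M) (k : Fin M) (w : S) {p : ℝ}
    (hp : p ∈ Set.Icc (1 / 3 : ℝ) (2 / 3)) :
    3⁻¹ * energy x (Sum.inl (x.2.2 k)) ≤ energy (jumpInside x k w p) (Sum.inr k) := by
  obtain ⟨-, -, h2, -⟩ := third_le hp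
  rw [energy_jumpInside, if_neg Sum.inr_ne_inl, if_pos rfl, pooled_eq]
  exact mul_le_mul' h2 le_self_add

theorem lintegral_pow_one_add (f : State S M → ℝ≥0∞) (hf : Measurable f) (n : ℕ) (x : State S M) :
    ∫⁻ y, f y ∂(ringKernel S τ M ^ (n + 1)) x =
      ∫⁻ z, ∫⁻ y, f y ∂(ringKernel S τ M ^ n) z ∂ringKernel S τ M x := by
  rw [_root_.pow_succ]
  exact Kernel.lintegral_comp _ _ _ hf

variable [Fintype S]

/-- The total energy. -/
def totalEnergy (x : State S M) : ℝ≥0 := ∑ v, x.1 v + ∑ k, x.2.1 k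

theorem totalEnergy_eq (x : State S M) : totalEnergy x = ∑ i, energy x i :=
  (Fintype.sum_sum_type fun i => energy x i).symm

theorem measurable_totalEnergy : Measurable fun x : State S M => totalEnergy x := by
  unfold totalEnergy
  fun_prop

theorem energy_le_totalEnergy (x : State S M) (i : S ⊕ Fin M) : energy x i ≤ totalEnergy x := by
  rw [totalEnergy_eq]
  exact Finset.single_le_sum (fun _ _ => zero_le) (Finset.mem_univ i)

theorem toNNReal_add_toNNReal_sub {p : ℝ} (hp : p ∈ Set.Icc (0 : ℝ) 1) :
    p.toNNReal + (1 - p).toNNReal = 1 := by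
  rw [← Real.toNNReal_add hp.1 (by linarith [hp.2])]
  simp

theorem totalEnergy_jumpInside (x : State S M) (k : Fin M) (w : S) {p : ℝ}
    (hp : p ∈ Set.Icc (0 : ℝ) 1) : totalEnergy (jumpInside x k w p) = totalEnergy x := by
  have h1 := sum_update_add x.1 (x.2.2 k) (p.toNNReal * pooled x k)
  have h2 := sum_update_add x.2.1 k ((1 - p).toNNReal * pooled x k)
  have h3 : p.toNNReal * pooled x k + (1 - p).toNNReal * pooled x k = x.1 (x.2.2 k) + x.2.1 k := by
    rw [← add_mul, toNNReal_add_toNNReal_sub hp, one_mul]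
    rfl
  refine add_right_cancel (b := x.1 (x.2.2 k) + x.2.1 k) ?_
  unfold totalEnergy jumpInside
  dsimp only
  rw [add_add_add_comm, h1, h2, add_add_add_comm, h3]

theorem totalEnergy_jumpBath (x : State S M) (k : Fin M) {p : ℝ} (e : ℝ)
    (hp : p ∈ Set.Icc (0 : ℝ) 1) :
    totalEnergy (jumpBath x k p e) + (1 - p).toNNReal * pooled x k =
      totalEnergy x + e.toNNReal := by
  have h1 := sum_update_add x.1 (x.2.2 k) (p.toNNReal * pooled x k)
  have h2 := sum_update_add x.2.1 k e.toNNReal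
  have h3 : p.toNNReal * pooled x k + (1 - p).toNNReal * pooled x k = x.1 (x.2.2 k) + x.2.1 k := by
    rw [← add_mul, toNNReal_add_toNNReal_sub hp, one_mul]
    rfl
  refine add_right_cancel (b := x.1 (x.2.2 k) + x.2.1 k) ?_
  unfold totalEnergy jumpBath
  dsimp only
  rw [add_right_comm, add_add_add_comm, h1, h2, ← h3]
  ring

/-- An upper bound for the temperatures of the bath. -/
def maxTemp (S : Set (Fin d → ℤ)) [Fintype S] (τ : (Fin d → ℤ) → ℝ) : ℝ≥0 :=
  ∑ q : S × (Fin d × Bool), (τ ((q.1 : Fin d → ℤ) + unitStep q.2)).toNNReal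

theorem ofReal_le_maxTemp (v : S) (a : Fin d × Bool) :
    ENNReal.ofReal (τ ((v : Fin d → ℤ) + unitStep a)) ≤ maxTemp S τ := by
  unfold ENNReal.ofReal maxTemp
  exact_mod_cast Finset.single_le_sum (f := fun q : S × (Fin d × Bool) =>
    (τ ((q.1 : Fin d → ℤ) + unitStep q.2)).toNNReal) (fun _ _ => zero_le) (Finset.mem_univ (v, a))

theorem measurable_coe_totalEnergy :
    Measurable fun x : State S M => (totalEnergy x : ℝ≥0∞) :=
  measurable_totalEnergy.coe_nnreal_ennreal

/-- The energy lost is `(1 - p) * pooled x k`. On the middle third, an event of probability `1/3`,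
it is at least a third of the pooled energy, which explains `9⁻¹`. -/
theorem lintegral_ringLaw_bath_le (hτ : ∀ w ∈ bath S, 0 < τ w) {k : Fin M} {a : Fin d × Bool}
    {x : State S M} (h : target x k a ∈ bath S) :
    ∫⁻ y, totalEnergy y ∂ringLaw S τ k a x + 9⁻¹ * pooled x k ≤ totalEnergy x + maxTemp S τ := by
  have hβ := inv_pos.2 (hτ _ h)
  have := isProbabilityMeasure_expMeasure hβ
  have hI : IsProbabilityMeasure ((volume : Measure ℝ).restrict (Set.Icc (0 : ℝ) 1)) := ⟨by simp⟩
  have hmJ := measurable_jumpBath_right x k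
  have hmV : Measurable fun q : ℝ × ℝ => (totalEnergy (jumpBath x k q.1 q.2) : ℝ≥0∞) :=
    measurable_coe_totalEnergy.comp hmJ
  rw [ringLaw, dif_neg h.2, if_pos h, lintegral_map measurable_coe_totalEnergy hmJ]
  set ρ := ((volume : Measure ℝ).restrict (Set.Icc (0 : ℝ) 1)).prod
    (expMeasure (τ (target x k a))⁻¹) with hρ
  have hae : ∀ᵐ q ∂ρ, q.1 ∈ Set.Icc (0 : ℝ) 1 :=
    Measure.quasiMeasurePreserving_fst.ae (ae_restrict_mem measurableSet_Icc)
  have e1 : ∫⁻ q, ((totalEnergy (jumpBath x k q.1 q.2) : ℝ≥0∞) +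
      ((1 - q.1).toNNReal * pooled x k : ℝ≥0)) ∂ρ =
        ∫⁻ q, (totalEnergy x + ENNReal.ofReal q.2) ∂ρ := by
    refine lintegral_congr_ae ?_
    filter_upwards [hae] with q hq
    rw [← ENNReal.coe_add, totalEnergy_jumpBath x k q.2 hq, ENNReal.coe_add]
    rfl
  rw [lintegral_add_left hmV, lintegral_add_left measurable_const, lintegral_const,
    measure_univ, mul_one] at e1
  have e2 : ∫⁻ q, ENNReal.ofReal q.2 ∂ρ = ENNReal.ofReal (τ (target x k a)) := by
    rw [hρ, lintegral_prod _ (by fun_prop)]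
    simp only [lintegral_ofReal_expMeasure hβ, inv_inv, lintegral_const, measure_univ, mul_one]
  have e3 : (9⁻¹ * pooled x k : ℝ≥0∞) ≤ ∫⁻ q, ((1 - q.1).toNNReal * pooled x k : ℝ≥0) ∂ρ := by
    have hm : Measurable fun p : ℝ => (((1 - p).toNNReal * pooled x k : ℝ≥0) : ℝ≥0∞) := by
      fun_prop
    rw [hρ, lintegral_prod _ (by fun_prop)]
    simp only [lintegral_const, measure_univ, mul_one]
    calc (9⁻¹ * pooled x k : ℝ≥0∞)
        = ∫⁻ p in Set.Icc (1 / 3 : ℝ) (2 / 3), ((3⁻¹ * pooled x k : ℝ≥0) : ℝ≥0∞) := by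
          rw [lintegral_const, Measure.restrict_apply_univ, Real.volume_Icc,
            show (2 / 3 - 1 / 3 : ℝ) = ((3⁻¹ : ℝ≥0) : ℝ) by push_cast; norm_num,
            ENNReal.ofReal_coe_nnreal, ← ENNReal.coe_mul,
            show (3⁻¹ * pooled x k * 3⁻¹ : ℝ≥0) = 9⁻¹ * pooled x k by
              rw [mul_right_comm, ← mul_inv]; norm_num,
            ENNReal.coe_mul, ENNReal.coe_inv (by norm_num)]
          rfl
      _ ≤ ∫⁻ p in Set.Icc (1 / 3 : ℝ) (2 / 3), (((1 - p).toNNReal * pooled x k : ℝ≥0) : ℝ≥0∞) := by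
          refine lintegral_mono_ae ?_
          filter_upwards [ae_restrict_mem measurableSet_Icc] with p hp
          have := (third_le hp).2.2.1
          gcongr
      _ ≤ _ := lintegral_mono' restrict_middle_le le_rfl
  calc _ ≤ ∫⁻ q, (totalEnergy (jumpBath x k q.1 q.2) : ℝ≥0∞) ∂ρ +
        ∫⁻ q, ((1 - q.1).toNNReal * pooled x k : ℝ≥0) ∂ρ := by gcongr
    _ = totalEnergy x + ENNReal.ofReal (τ (target x k a)) := by rw [e1, e2]
    _ ≤ _ := by gcongr; exact ofReal_le_maxTemp _ _

theorem lintegral_ringLaw_le (hτ : ∀ w ∈ bath S, 0 < τ w) (k : Fin M) (a : Fin d × Bool)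
    (x : State S M) :
    ∫⁻ y, totalEnergy y ∂ringLaw S τ k a x ≤ totalEnergy x + maxTemp S τ := by
  by_cases h : target x k a ∈ S
  · rw [ringLaw, dif_pos h,
      lintegral_map measurable_coe_totalEnergy (measurable_jumpInside_right x k _)]
    refine le_trans (le_of_eq ?_) le_self_add
    have e : ∫⁻ p in Set.Icc (0 : ℝ) 1,
        (totalEnergy (jumpInside x k ⟨target x k a, h⟩ p) : ℝ≥0∞) =
          ∫⁻ p in Set.Icc (0 : ℝ) 1, (totalEnergy x : ℝ≥0∞) := by
      refine setLIntegral_congr_fun measurableSet_Icc fun p hp => ?_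
      rw [totalEnergy_jumpInside x k _ hp]
    rw [e]
    simp
  · by_cases h' : target x k a ∈ bath S
    · exact le_self_add.trans (lintegral_ringLaw_bath_le hτ h')
    · rw [ringLaw, dif_neg h, if_neg h', lintegral_dirac' _ measurable_coe_totalEnergy]
      exact le_self_add

theorem sum_choiceProb (hd : 0 < d) (hM : 0 < M) (c : ℝ≥0∞) :
    ∑ _k : Fin M, ∑ _a : Fin d × Bool, choiceProb d M * c = c := by
  simp only [Finset.sum_const, Finset.card_univ, Fintype.card_prod, Fintype.card_fin,
    Fintype.card_bool, nsmul_eq_mul]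
  rw [← mul_assoc, ← mul_assoc, ← Nat.cast_mul, choiceProb,
    show M * (d * 2) = 2 * d * M by ring, ENNReal.mul_inv_cancel (by simp; omega)
    (ENNReal.natCast_ne_top _), one_mul]

/-- A gain `g` for one choice of particle and direction survives averaging over all choices with the
factor `choiceProb d M`. -/
theorem lintegral_ringKernel_add_le (hd : 0 < d) (hM : 0 < M) {x : State S M} {b : ℝ≥0∞}
    (h : ∀ k a, ∫⁻ y, totalEnergy y ∂ringLaw S τ k a x ≤ b) {k₀ : Fin M} {a₀ : Fin d × Bool}
    {g : ℝ≥0∞} (h₀ : ∫⁻ y, totalEnergy y ∂ringLaw S τ k₀ a₀ x + g ≤ b) :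
    ∫⁻ y, totalEnergy y ∂ringKernel S τ M x + choiceProb d M * g ≤ b := by
  classical
  have e1 : ∫⁻ y, totalEnergy y ∂ringKernel S τ M x =
      ∑ k, ∑ a, choiceProb d M * ∫⁻ y, totalEnergy y ∂ringLaw S τ k a x := by
    rw [ringKernel_apply, lintegral_finsetSum_measure]
    refine Finset.sum_congr rfl fun k _ => ?_
    rw [lintegral_finsetSum_measure]
    exact Finset.sum_congr rfl fun a _ => lintegral_smul_measure _ _
  have e2 : choiceProb d M * g =
      ∑ k, ∑ a, choiceProb d M * (if k = k₀ ∧ a = a₀ then g else 0) := by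
    rw [Finset.sum_eq_single k₀ (fun k _ hk => by simp [hk]) (by simp),
      Finset.sum_eq_single a₀ (fun a _ ha => by simp [ha]) (by simp)]
    simp
  rw [e1, e2, ← Finset.sum_add_distrib, ← sum_choiceProb hd hM b]
  refine Finset.sum_le_sum fun k _ => ?_
  rw [← Finset.sum_add_distrib]
  refine Finset.sum_le_sum fun a _ => ?_
  rw [← mul_add]
  gcongr
  split_ifs with hka
  · rw [hka.1, hka.2]; exact h₀
  · rw [add_zero]; exact h k a

theorem lintegral_ringKernel_le (hd : 0 < d) (hM : 0 < M) (hτ : ∀ w ∈ bath S, 0 < τ w)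
    (x : State S M) :
    ∫⁻ y, totalEnergy y ∂ringKernel S τ M x ≤ totalEnergy x + maxTemp S τ := by
  have := lintegral_ringKernel_add_le hd hM (lintegral_ringLaw_le hτ · · x)
    (k₀ := ⟨0, hM⟩) (a₀ := (⟨0, hd⟩, true)) (g := 0)
    (by rw [add_zero]; exact lintegral_ringLaw_le hτ _ _ x)
  rwa [mul_zero, add_zero] at this

theorem lintegral_pow_ringKernel_le (hd : 0 < d) (hM : 0 < M) (hτ : ∀ w ∈ bath S, 0 < τ w)
    (n : ℕ) (x : State S M) :
    ∫⁻ y, totalEnergy y ∂(ringKernel S τ M ^ n) x ≤ totalEnergy x + n * maxTemp S τ := by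
  have := isMarkovKernel_ringKernel hd hτ hM
  induction n generalizing x with
  | zero =>
    change ∫⁻ y, totalEnergy y ∂(Kernel.id : Kernel (State S M) (State S M)) x ≤ _
    rw [Kernel.id_apply, lintegral_dirac' _ measurable_coe_totalEnergy]
    exact le_self_add
  | succ n ih =>
    rw [lintegral_pow_one_add _ measurable_coe_totalEnergy]
    calc _ ≤ ∫⁻ z, (totalEnergy z + n * maxTemp S τ : ℝ≥0∞) ∂ringKernel S τ M x :=
          lintegral_mono ih
      _ = ∫⁻ z, totalEnergy z ∂ringKernel S τ M x + n * maxTemp S τ := by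
          rw [lintegral_add_right _ measurable_const]; simp
      _ ≤ totalEnergy x + maxTemp S τ + n * maxTemp S τ := by
          gcongr; exact lintegral_ringKernel_le hd hM hτ x
      _ = _ := by push_cast; ring

/-- From the states with the positions `X`, a fixed fraction of the energy of the coordinate `i` is
lost to the bath, in the mean, after some number of rings. -/
def Drained (τ : (Fin d → ℤ) → ℝ) (X : Fin M → S) (i : S ⊕ Fin M) : Prop :=
  ∃ n : ℕ, ∃ c : ℝ≥0∞, c ≠ 0 ∧ ∀ x : State S M, x.2.2 = X →
    ∫⁻ y, totalEnergy y ∂(ringKernel S τ M ^ n) x + c * energy x i ≤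
      totalEnergy x + n * maxTemp S τ

theorem Drained.jump_bath (hd : 0 < d) (hM : 0 < M) (hτ : ∀ w ∈ bath S, 0 < τ w)
    {X : Fin M → S} {k : Fin M} {a : Fin d × Bool}
    (h : (X k : Fin d → ℤ) + unitStep a ∈ bath S) {i : S ⊕ Fin M}
    (hi : i = Sum.inl (X k) ∨ i = Sum.inr k) : Drained τ X i := by
  refine ⟨1, choiceProb d M * 9⁻¹, mul_ne_zero (choiceProb_ne_zero d M) (by simp),
    fun x hx => ?_⟩
  have ht : target x k a ∈ bath S := by rw [target, hx]; exact h
  have h1 := lintegral_ringKernel_add_le hd hM (lintegral_ringLaw_le hτ · · x)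
    (lintegral_ringLaw_bath_le hτ ht)
  have h2 : energy x i ≤ pooled x k := by
    rw [pooled_eq, hx]
    rcases hi with rfl | rfl
    · exact le_self_add
    · exact le_add_self
  rw [_root_.pow_one, Nat.cast_one, one_mul]
  refine le_trans ?_ h1
  rw [mul_assoc]
  gcongr

/-- With positive probability the ring hands a third of the energy of `i` over to `j`, from which it
is drained afterwards. -/
theorem Drained.step (hd : 0 < d) (hM : 0 < M) (hτ : ∀ w ∈ bath S, 0 < τ w)
    {X : Fin M → S} {k : Fin M} {w : S} (h : (latticeGraph d).Adj (X k) w) {i j : S ⊕ Fin M}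
    (hij : ∀ x : State S M, x.2.2 = X → ∀ p ∈ Set.Icc (1 / 3 : ℝ) (2 / 3),
      3⁻¹ * energy x i ≤ energy (jumpInside x k w p) j)
    (hj : Drained τ (Function.update X k w) j) : Drained τ X i := by
  have := isMarkovKernel_ringKernel hd hτ hM
  obtain ⟨n, c, hc, hn⟩ := hj
  have hρ := middleMeasure_ne_zero d M
  refine ⟨n + 1, c * (((3⁻¹ : ℝ≥0) : ℝ≥0∞) * middleMeasure d M Set.univ), ?_, fun x hx => ?_⟩
  · refine mul_ne_zero hc (mul_ne_zero (by simp) (by simpa using hρ))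
  set W : Set (State S M) := {y | y.2.2 = Function.update X k w} with hW
  have hWm : MeasurableSet W :=
    (measurable_snd.comp measurable_snd) (measurableSet_singleton (Function.update X k w))
  -- The loss is counted only if the prescribed jump occurs; otherwise the general growth bound is
  -- used.
  set g : State S M → ℝ≥0∞ := W.indicator fun y => (energy y j : ℝ≥0∞) with hg
  have hgm : Measurable g := (measurable_energy j).coe_nnreal_ennreal.indicator hWm
  have hlow : (((3⁻¹ : ℝ≥0) : ℝ≥0∞) * middleMeasure d M Set.univ) * energy x i ≤
      ∫⁻ y, g y ∂ringKernel S τ M x := by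
    calc (((3⁻¹ : ℝ≥0) : ℝ≥0∞) * middleMeasure d M Set.univ) * energy x i
        = ∫⁻ _, ((3⁻¹ * energy x i : ℝ≥0) : ℝ≥0∞) ∂middleMeasure d M := by
          rw [lintegral_const, ENNReal.coe_mul]; ring
      _ ≤ ∫⁻ p, g (jumpInside x k w p) ∂middleMeasure d M := by
          refine lintegral_mono_ae ?_
          filter_upwards [ae_middleMeasure d M] with p hp
          have hmem : jumpInside x k w p ∈ W := by
            change Function.update x.2.2 k w = _
            rw [hx]
          rw [hg, Set.indicator_of_mem hmem]
          exact_mod_cast hij x hx p hp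
      _ = ∫⁻ y, g y ∂(middleMeasure d M).map (jumpInside x k w) :=
          (lintegral_map hgm (measurable_jumpInside_right x k w)).symm
      _ ≤ _ := lintegral_mono' (map_middleMeasure_le (by rwa [hx])) le_rfl
  have hpt : ∀ z, ∫⁻ y, totalEnergy y ∂(ringKernel S τ M ^ n) z + c * g z ≤
      totalEnergy z + n * maxTemp S τ := by
    intro z
    by_cases hz : z ∈ W
    · rw [hg, Set.indicator_of_mem hz]
      exact hn z hz
    · rw [hg, Set.indicator_of_notMem hz, mul_zero, add_zero]
      exact lintegral_pow_ringKernel_le hd hM hτ n z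
  rw [lintegral_pow_one_add _ measurable_coe_totalEnergy, mul_assoc]
  calc _ ≤ ∫⁻ z, ∫⁻ y, totalEnergy y ∂(ringKernel S τ M ^ n) z ∂ringKernel S τ M x +
        c * ∫⁻ y, g y ∂ringKernel S τ M x := by gcongr
    _ = ∫⁻ z, (∫⁻ y, totalEnergy y ∂(ringKernel S τ M ^ n) z + c * g z) ∂ringKernel S τ M x := by
        rw [lintegral_add_right _ (hgm.const_mul c), lintegral_const_mul _ hgm]
    _ ≤ ∫⁻ z, (totalEnergy z + n * maxTemp S τ : ℝ≥0∞) ∂ringKernel S τ M x := lintegral_mono hpt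
    _ = ∫⁻ z, totalEnergy z ∂ringKernel S τ M x + n * maxTemp S τ := by
        rw [lintegral_add_right _ measurable_const]; simp
    _ ≤ totalEnergy x + maxTemp S τ + n * maxTemp S τ := by
        gcongr; exact lintegral_ringKernel_le hd hM hτ x
    _ = _ := by push_cast; ring

theorem Drained.of_move (hd : 0 < d) (hM : 0 < M) (hτ : ∀ w ∈ bath S, 0 < τ w)
    (hS : ((latticeGraph d).induce S).Connected) {X : Fin M → S} {i : S ⊕ Fin M} {k : Fin M}
    {w : S} (h : Drained τ (Function.update X k w) i) : Drained τ X i := by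
  obtain ⟨p⟩ := hS.preconnected (X k) w
  generalize hu : X k = u at p
  induction p generalizing X with
  | nil => rwa [← hu, Function.update_eq_self] at h
  | cons hadj p ih =>
    refine Drained.step hd hM hτ (k := k) (by rw [hu]; exact hadj)
      (fun x _ p hp => third_energy_le_jumpInside x k _ i hp) (ih ?_ (Function.update_self _ _ _))
    rwa [Function.update_idem]

/-- A particle drains its own energy by walking to `v₀` and exchanging with the bath. A site is
visited by particle 0, which takes a share of its energy and is then drained, or exchanges with the
bath at once if the site is `v₀`. -/
theorem Drained.all (hd : 0 < d) (hM : 0 < M) (hτ : ∀ w ∈ bath S, 0 < τ w)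
    (hS : ((latticeGraph d).induce S).Connected) {v₀ : S} {a₀ : Fin d × Bool}
    (h₀ : (v₀ : Fin d → ℤ) + unitStep a₀ ∈ bath S) (X : Fin M → S) (i : S ⊕ Fin M) :
    Drained τ X i := by
  have hpart : ∀ (X : Fin M → S) k, Drained τ X (Sum.inr k) := fun X k =>
    Drained.of_move hd hM hτ hS (k := k) (w := v₀)
      (Drained.jump_bath hd hM hτ (k := k) (a := a₀) (by rwa [Function.update_self]) (Or.inr rfl))
  rcases i with v | k
  · refine Drained.of_move hd hM hτ hS (k := ⟨0, hM⟩) (w := v) ?_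
    set Y := Function.update X (⟨0, hM⟩ : Fin M) v with hY
    have hYv : Y ⟨0, hM⟩ = v := Function.update_self _ _ _
    by_cases hv : v = v₀
    · exact Drained.jump_bath hd hM hτ (k := ⟨0, hM⟩) (a := a₀) (by rwa [hYv, hv])
        (Or.inl (by rw [hYv]))
    · obtain ⟨w, hw, -⟩ := exists_adj_of_ne hS hv
      refine Drained.step hd hM hτ (k := ⟨0, hM⟩) (w := w) (by rwa [hYv]) (fun x hx p hp => ?_)
        (hpart _ ⟨0, hM⟩)
      have := third_energy_le_jumpInside_particle x ⟨0, hM⟩ w hp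
      rwa [hx, hYv] at this
  · exact hpart X k

/-- The gain is used on the event of exactly `n` rings; for any other number of rings the energy
grows by at most `maxTemp S τ` per ring in the mean. -/
theorem lintegral_transition_add_le (hd : 0 < d) (hM : 0 < M) (hτ : ∀ w ∈ bath S, 0 < τ w)
    {x : State S M} {n : ℕ} {g : ℝ≥0∞}
    (h : ∫⁻ y, totalEnergy y ∂(ringKernel S τ M ^ n) x + g ≤ totalEnergy x + n * maxTemp S τ)
    (t : ℝ≥0) :
    ∫⁻ y, totalEnergy y ∂transition S τ M t x + g * poissonMeasure (M * t) {n} ≤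
      totalEnergy x + (∫⁻ m, (m : ℝ≥0∞) ∂poissonMeasure (M * t)) * maxTemp S τ := by
  have e1 : ∫⁻ y, totalEnergy y ∂transition S τ M t x =
      ∫⁻ m, ∫⁻ y, totalEnergy y ∂(ringKernel S τ M ^ m) x ∂poissonMeasure (M * t) :=
    Measure.lintegral_bind Measurable.of_discrete.aemeasurable
      measurable_coe_totalEnergy.aemeasurable
  have e2 : g * poissonMeasure (M * t) {n} =
      ∫⁻ m, Set.indicator {n} (fun _ => g) m ∂poissonMeasure (M * t) := by
    rw [lintegral_indicator (measurableSet_singleton n), setLIntegral_const]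
  rw [e1, e2, ← lintegral_add_left Measurable.of_discrete]
  calc _ ≤ ∫⁻ m : ℕ, ((totalEnergy x : ℝ≥0∞) + m * maxTemp S τ) ∂poissonMeasure (M * t) := by
        refine lintegral_mono fun m => ?_
        by_cases hm : m = n
        · subst hm
          simpa using h
        · simpa [hm] using lintegral_pow_ringKernel_le hd hM hτ m x
    _ = _ := by
        rw [lintegral_add_left measurable_const, lintegral_mul_const _ Measurable.of_discrete]
        simp

/-- The total energy is a Lyapunov function. -/
theorem exists_drift (hd : 0 < d) (hM : 0 < M) (hτ : ∀ w ∈ bath S, 0 < τ w)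
    (hS : ((latticeGraph d).induce S).Connected) {v₀ : S} {a₀ : Fin d × Bool}
    (h₀ : (v₀ : Fin d → ℤ) + unitStep a₀ ∈ bath S) :
    ∃ γ K : ℝ≥0, γ < 1 ∧ ∀ x : State S M,
      ∫⁻ y, totalEnergy y ∂transition S τ M 1 x ≤ γ * totalEnergy x + K := by
  classical
  choose n c hc hn using fun q : (Fin M → S) × (S ⊕ Fin M) =>
    Drained.all (τ := τ) hd hM hτ hS h₀ q.1 q.2
  set b : ℝ≥0∞ := Finset.univ.inf fun q : (Fin M → S) × (S ⊕ Fin M) =>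
    c q * poissonMeasure (M * (1 : ℝ≥0)) {n q} with hb
  have hb0 : 0 < b := (Finset.lt_inf_iff ENNReal.zero_lt_top).2 fun q _ =>
    pos_iff_ne_zero.2 (mul_ne_zero (hc q) (poissonMeasure_singleton_ne_zero hM _))
  -- `b` may be infinite; `ε` is a finite positive number below it and below one.
  obtain ⟨ε, hε0, hεb⟩ := ENNReal.lt_iff_exists_nnreal_btwn.1 (lt_min hb0 one_pos)
  have hε0' : 0 < ε := by exact_mod_cast hε0
  have hε1 : ε ≤ 1 := by exact_mod_cast (hεb.trans_le (min_le_right _ _)).le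
  have hm := lintegral_natCast_poissonMeasure_lt_top (M * (1 : ℝ≥0))
  obtain ⟨m, hm'⟩ : ∃ m : ℝ≥0,
      (m : ℝ≥0∞) = ∫⁻ j, (j : ℝ≥0∞) ∂poissonMeasure (M * (1 : ℝ≥0)) :=
    ⟨_, ENNReal.coe_toNNReal hm.ne⟩
  set N : ℝ≥0 := ((Fintype.card (S ⊕ Fin M) : ℕ) : ℝ≥0) with hN
  have hN1 : 1 ≤ N := by
    have : 1 ≤ Fintype.card (S ⊕ Fin M) := Fintype.card_pos_iff.2 ⟨Sum.inl v₀⟩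
    rw [hN]
    exact_mod_cast this
  have hN0 : 0 < N := lt_of_lt_of_le one_pos hN1
  -- The inequality `hx` holds for each of the `N` coordinates, with the same integral on the left.
  -- Their average replaces the energy of one coordinate by the total energy divided by `N`.
  refine ⟨1 - ε / N, m * maxTemp S τ, tsub_lt_self one_pos (div_pos hε0' hN0), fun x => ?_⟩
  have hx : ∀ i, ∫⁻ y, totalEnergy y ∂transition S τ M 1 x + ε * energy x i ≤
      totalEnergy x + m * maxTemp S τ := by
    intro i
    have h1 := lintegral_transition_add_le hd hM hτ (hn (x.2.2, i) x rfl) 1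
    rw [← hm'] at h1
    refine le_trans ?_ h1
    rw [mul_right_comm]
    gcongr
    exact (hεb.le.trans (min_le_left _ _)).trans (Finset.inf_le (f := fun q =>
      c q * poissonMeasure (M * (1 : ℝ≥0)) {n q}) (Finset.mem_univ (x.2.2, i)))
  have hfin : ∫⁻ y, totalEnergy y ∂transition S τ M 1 x ≠ ∞ := by
    refine ne_top_of_le_ne_top ?_ (le_self_add.trans (hx (Sum.inl v₀)))
    exact_mod_cast ENNReal.coe_ne_top (r := totalEnergy x + m * maxTemp S τ)
  obtain ⟨I, hI⟩ : ∃ I : ℝ≥0, (I : ℝ≥0∞) = ∫⁻ y, totalEnergy y ∂transition S τ M 1 x :=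
    ⟨_, ENNReal.coe_toNNReal hfin⟩
  rw [← hI] at hx ⊢
  have hx' : ∀ i, I + ε * energy x i ≤ totalEnergy x + m * maxTemp S τ := fun i => by
    exact_mod_cast hx i
  have hsum := Finset.sum_le_sum fun i (_ : i ∈ Finset.univ) => hx' i
  rw [Finset.sum_add_distrib, ← Finset.mul_sum, ← totalEnergy_eq, Finset.sum_const,
    Finset.sum_const, Finset.card_univ, nsmul_eq_mul, nsmul_eq_mul, ← hN] at hsum
  have hγ : ε / N ≤ 1 := (div_le_one hN0).2 (hε1.trans hN1)
  have key : I ≤ (1 - ε / N) * totalEnergy x + m * maxTemp S τ := by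
    rw [← NNReal.coe_le_coe] at hsum ⊢
    push_cast [NNReal.coe_sub hγ] at hsum ⊢
    have hN0' : (0 : ℝ) < N := by exact_mod_cast hN0
    refine le_of_mul_le_mul_left ?_ hN0'
    have : (N : ℝ) * ((1 - ε / N) * totalEnergy x + m * maxTemp S τ) =
        N * (totalEnergy x + m * maxTemp S τ) - ε * totalEnergy x := by
      field_simp
      ring
    rw [this]
    linarith
  exact_mod_cast key

end Drift

/-! ### The lattice points of a bounded domain -/

section Lattice

variable {d : ℕ}

theorem IsAdmissibleDomain.isBounded {D : Set (EuclideanSpace ℝ (Fin d))}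
    (hD : IsAdmissibleDomain D) : Bornology.IsBounded D := by
  rcases hD with ⟨a, b, -, φ, rfl⟩ | hD
  · refine φ.isometry.lipschitz.isBounded_image ?_
    have h := (PiLp.antilipschitzWith_ofLp 2 (fun _ : Fin d => ℝ)).isBounded_preimage
      (Metric.isBounded_Icc a b)
    exact h.subset fun x hx => ⟨fun i => (hx i).1.le, fun i => (hx i).2.le⟩
  · exact hD.2.2.1

theorem finite_sites {D : Set (EuclideanSpace ℝ (Fin d))} (hD : Bornology.IsBounded D) (L : ℝ) :
    (sites D L).Finite := by
  obtain ⟨C, hC⟩ := (hD.smul₀ L).exists_norm_le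
  refine (Set.finite_Icc (fun _ : Fin d => -⌈C⌉) (fun _ => ⌈C⌉)).subset fun v hv => ?_
  have h : ∀ i, |(v i : ℝ)| ≤ ⌈C⌉ := fun i =>
    ((PiLp.norm_apply_le (toSpace v) i).trans (hC _ hv)).trans (Int.le_ceil C)
  exact ⟨fun i => by have := (abs_le.1 (h i)).1; exact_mod_cast this,
    fun i => by have := (abs_le.1 (h i)).2; exact_mod_cast this⟩

/-- A finite nonempty set of sites has a site next to the bath. -/
theorem exists_adj_bath (hd : 0 < d) (S : Set (Fin d → ℤ)) [Finite S] [Nonempty S] :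
    ∃ (v : S) (a : Fin d × Bool), (v : Fin d → ℤ) + unitStep a ∈ bath S := by
  set i₀ : Fin d := ⟨0, hd⟩
  obtain ⟨v, hv⟩ := Finite.exists_max fun v : S => (v : Fin d → ℤ) i₀
  have hup : ∀ w : Fin d → ℤ, (v : Fin d → ℤ) i₀ < w i₀ → w ∉ S := fun w hw hwS =>
    (hv ⟨w, hwS⟩).not_gt hw
  have hstep : (unitStep (i₀, true) : Fin d → ℤ) i₀ = 1 := by simp [unitStep]
  -- At a site where the coordinate `i₀` is maximal, one step up leaves `S`, and the next step up
  -- stays outside `S`.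
  refine ⟨v, (i₀, true), ⟨⟨v, ?_, v.2⟩, _, ⟨(i₀, true), rfl⟩, hup _ ?_⟩, hup _ ?_⟩
  · exact SimpleGraph.Adj.symm (G := latticeGraph d) ⟨_, rfl⟩
  · simp only [Pi.add_apply, hstep]
    omega
  · simp only [Pi.add_apply, hstep]
    omega

end Lattice

/-- The process on a finite connected set of sites has a unique invariant probability measure, to
which it converges in total variation. -/
theorem exists_unique_invariant {d : ℕ} (hd : 0 < d) {S : Set (Fin d → ℤ)} [Finite S]
    (hS : ((latticeGraph d).induce S).Connected) {τ : (Fin d → ℤ) → ℝ}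
    (hτ : ∀ w ∈ bath S, 0 < τ w) {M : ℕ} (hM : 0 < M) :
    ∃ μ : Measure (State S M), IsProbabilityMeasure μ ∧
      (∀ t, (transition S τ M t).Invariant μ) ∧
      (∀ μ' : Measure (State S M), IsProbabilityMeasure μ' →
        (∀ t, (transition S τ M t).Invariant μ') → μ' = μ) ∧
      ∀ ν : Measure (State S M), IsProbabilityMeasure ν →
        TendstoInTotalVariation (fun t => ν.bind (transition S τ M t)) μ := by
  have := Fintype.ofFinite S
  have := hS.nonempty
  obtain ⟨v₀, a₀, h₀⟩ := exists_adj_bath hd S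
  obtain ⟨γ, K, hγ, hdrift⟩ := exists_drift hd hM hτ hS h₀
  have hP := isMarkovKernel_transition hd hτ hM
  refine exists_unique_invariant_of_drift (transition S τ M) (transition_add hd hτ hM)
    measurable_totalEnergy hγ hdrift fun R => ?_
  obtain ⟨ν, hν0, hν⟩ := exists_le_transition hd hM hS hτ h₀ R
  exact ⟨ν, hν0, fun x hx => hν x fun i => (energy_le_totalEnergy x i).trans hx⟩

end EnergyExchange

end

theorem proposition2 (d : ℕ) (hd : 0 < d)
    (D : Set (EuclideanSpace ℝ (Fin d))) (hD : IsAdmissibleDomain D)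
    -- the temperature, extended to a neighbourhood `U` of the boundary of `D`
    (U : Set (EuclideanSpace ℝ (Fin d))) (hU : IsOpen U) (hDU : frontier D ⊆ U)
    (T : EuclideanSpace ℝ (Fin d) → ℝ) (hT : ContinuousOn T U) (hTpos : ∀ x ∈ U, 0 < T x)
    -- the scale, which is so large that the temperature is defined on the rescaled bath
    (L : ℝ) (hL : 0 < L) (hLU : ∀ w ∈ bath (sites D L), L⁻¹ • toSpace w ∈ U)
    (hconn : ((latticeGraph d).induce (sites D L)).Connected)
    -- the number of particles
    (M : ℕ) (hM : 0 < M) :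
    ∃ μ : Measure (State (sites D L) M), IsProbabilityMeasure μ ∧
      (∀ t, (transition (sites D L) (fun w => T (L⁻¹ • toSpace w)) M t).Invariant μ) ∧
      (∀ μ' : Measure (State (sites D L) M), IsProbabilityMeasure μ' →
        (∀ t, (transition (sites D L) (fun w => T (L⁻¹ • toSpace w)) M t).Invariant μ') →
          μ' = μ) ∧
      ∀ ν : Measure (State (sites D L) M), IsProbabilityMeasure ν →
        TendstoInTotalVariation
          (fun t => ν.bind (transition (sites D L) (fun w => T (L⁻¹ • toSpace w)) M t)) μ := by
  have := (finite_sites hD.isBounded L).to_subtype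
  exact exists_unique_invariant hd hconn (fun w hw => hTpos _ (hLU w hw)) hM
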